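/- **Setting.** Fix constants $0<\underline E\le\overline E$, $0<\underline P\le\overline P$, $P_{\mathrm{rel}}>0$, $\sigma>0$. A network with $M$ source-destination pairs and $K$ relays is given by numbers $E_{k,m}\in[\underline E,\overline E]$, $P_{m,k}\in[\underline P,\overline P]$ ($1\le k\le K$, $1\le m\le M$) and a map $p:\{1,\dots,K\}\to\{1,\dots,M\}$ each of whose fibres has exactly $K/M$ elements (so $M$ divides $K$). The channel gains $h_{k,m}$ (first hop) and $f_{m,k}$ (second hop) are jointly independent $\mathcal{CN}(0,1)$ random variables. Put $\tilde z=e^{j\arg z}$ and $$d_k=\sqrt{P_{\mathrm{rel}}}\Bigl[\tfrac KM\sum_{m=1}^M E_{k,m}+K\sigma^2\Bigr]^{-1/2},\qquad C_k^{m,\hat m}=\sqrt K\,d_k\sqrt{P_{m,k}E_{k,\hat m}},\qquad C_k^{m}=\sqrt K\,d_k\sqrt{P_{m,k}},$$ $$a_k^{m,\hat m}=C_k^{m,\hat m}\,\tilde f_{p(k),k}^{*}f_{m,k}\,\tilde h_{k,p(k)}^{*}h_{k,\hat m},\qquad b_k^m=C_k^m\,\tilde f_{p(k),k}^{*}f_{m,k}\,\tilde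 h_{k,p(k)}^{*}.$$ The SINR of link $m$ under protocol P1 is $$\mathrm{SINR}_m=\frac{\bigl|\sum_{k}a_k^{m,m}\bigr|^2}{\sum_{\hat m\ne m}\bigl|\sum_k a_k^{m,\hat m}\bigr|^2+\sigma^2M\sum_k|b_k^m|^2+KM\sigma^2},$$ and its outage probability at rate $R$ is $P_{\mathrm{out}}(R)=\mathbb P\{\tfrac12\log_2(1+\mathrm{SINR}_m)\le R\}$. Let $$\underline C=\sqrt{\tfrac{\underline P\,\underline E\,P_{\mathrm{rel}}}{\overline E+\sigma^2}},\quad \overline C=\sqrt{\tfrac{\overline P\,\overline E\,P_{\mathrm{rel}}}{\underline E+\sigma^2}},\quad \overline c=\sqrt{\tfrac{\overline P\,P_{\mathrm{rel}}}{\underline E+\sigma^2}},\quad \overline C_{\mathrm{SN}}=\sqrt{\overline C^2+\sigma^2(\overline c^2+1)},$$ $$\Delta_{\mathrm{P1}}=\min\Bigl[2^{-10/21},\ \tfrac1{2^{31/21}\overline C^2},\ \tfrac1{8\overline C^4},\ \tfrac1{4\overline c^4}\Bigr],\qquad e(M,K,R)=\frac{16}{\pi^2}\frac{\overline C_{\mathrm{SN}}^2}{\underline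 C^2}\frac{M^3}{K}\bigl(2^{2R}-1\bigr),$$ $$x(R)=x(M,K,R)=\frac{1-e(M,K,R)}{\frac{16}{\underline C\pi}\frac{M}{\sqrt K}+e(M,K,R)\Bigl(\frac{3}{\overline C_{\mathrm{SN}}^2}\frac1{\sqrt M}+\frac{\sigma^2}{\overline C_{\mathrm{SN}}^2}\frac1{\sqrt K}\Bigr)}.$$ **Theorem (outage probability for P1).** 1. Let $K\ge2$, $M\ge2$ and $R\ge0$ be such that $x(R)\ge1$. Then, for every network with $M$ pairs and $K$ relays and every link $m$, $$P_{\mathrm{out}}(R)\le 151\,K^2M\,e^{-\Delta_{\mathrm{P1}}x(R)^{2/7}}.$$ 2. Let $0<\varepsilon<1$ and $\delta>0$, and let $M_n,K_n\in\mathbb N$ and $R_n\ge0$ satisfy $M_n\to\infty$, $K_n\ge M_n^{3+\delta}$ and $$R_n\le\frac12\log_2\Bigl(1+\frac{\pi^2}{16}\frac{\underline C^2}{\overline C_{\mathrm{SN}}^2}\frac{K_n}{M_n^3}(1-\varepsilon)\Bigr)\qquad\text{for all }n.$$ (a) If the rates $R_n$ are bounded (in particular, if $R_n=R$ is fixed),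 or if $\ln K_n/M_n^{1/7}\to0$ (in particular, if $K_n$ grows at most polynomially in $M_n$), then $151\,K_n^2M_n\,e^{-\Delta_{\mathrm{P1}}x(M_n,K_n,R_n)^{2/7}}\to0$. (b) In all cases, for any networks with $M_n$ pairs and $K_n$ relays and any links $m_n$ in them (with the fixed constants above), the outage probability of link $m_n$ at rate $R_n$ tends to $0$. -/

import Mathlib

open MeasureTheory ProbabilityTheory Filter Topology
open scoped NNReal

noncomputable section

/-- The law `CN(0, v)` of `X + j Y` with `X`, `Y` independent `N(0, v/2)`. -/
def circGaussian (v : ℝ≥0) : Measure ℂ :=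
  ((gaussianReal 0 (v / 2)).prod (gaussianReal 0 (v / 2))).map
    (fun q : ℝ × ℝ => (q.1 : ℂ) + (q.2 : ℂ) * Complex.I)

/-- The constants of the model that do not depend on the numbers of terminals: uniform bounds on
the received energies of the two hops, the relay power and the noise standard deviation. -/
structure RelayConstants where
  Emin : ℝ
  Emax : ℝ
  Pmin : ℝ
  Pmax : ℝ
  Prel : ℝ
  σ : ℝ
  Emin_pos : 0 < Emin
  Emin_le_Emax : Emin ≤ Emax
  Pmin_pos : 0 < Pmin
  Pmin_le_Pmax : Pmin ≤ Pmax
  Prel_pos : 0 < Prel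
  σ_pos : 0 < σ

namespace RelayConstants

variable (c : RelayConstants)

/-- The lower bound on the coefficients `C_k^{m,m̂}`. -/
def CLow : ℝ := √(c.Pmin * c.Emin * c.Prel / (c.Emax + c.σ ^ 2))

/-- The upper bound on the coefficients `C_k^{m,m̂}`. -/
def CUp : ℝ := √(c.Pmax * c.Emax * c.Prel / (c.Emin + c.σ ^ 2))

/-- The upper bound on the coefficients `C_k^m`. -/
def cUp : ℝ := √(c.Pmax * c.Prel / (c.Emin + c.σ ^ 2))

/-- The constant `C̄_SN`. -/
def CSN : ℝ := √(c.CUp ^ 2 + c.σ ^ 2 * (c.cUp ^ 2 + 1))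

/-- The exponent constant `Δ_P1`. -/
def ΔP1 : ℝ :=
  min (min ((2 : ℝ) ^ (-(10 / 21 : ℝ))) (1 / ((2 : ℝ) ^ (31 / 21 : ℝ) * c.CUp ^ 2)))
    (min (1 / (8 * c.CUp ^ 4)) (1 / (4 * c.cUp ^ 4)))

/-- The quantity `e_P1(M, K, R)`. -/
def eP1 (M K : ℕ) (R : ℝ) : ℝ :=
  16 / Real.pi ^ 2 * (c.CSN ^ 2 / c.CLow ^ 2) * ((M : ℝ) ^ 3 / K) * ((2 : ℝ) ^ (2 * R) - 1)

/-- The quantity `x(R)`, for `M` source-destination pairs and `K` relays. -/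
def xP1 (M K : ℕ) (R : ℝ) : ℝ :=
  (1 - c.eP1 M K R) /
    (16 / (c.CLow * Real.pi) * (M / √(K : ℝ)) +
      c.eP1 M K R *
        (3 / c.CSN ^ 2 * (1 / √(M : ℝ)) + c.σ ^ 2 / c.CSN ^ 2 * (1 / √(K : ℝ))))

/-- The upper bound `151 K² M exp(-Δ_P1 x(R)^{2/7})` on the outage probability. -/
def outageBoundP1 (M K : ℕ) (R : ℝ) : ℝ :=
  151 * (K : ℝ) ^ 2 * M * Real.exp (-(c.ΔP1 * c.xP1 M K R ^ (2 / 7 : ℝ)))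

/-- The lower bound on the ergodic capacity, with back-off factor `1 - ε`, in bits. -/
def rateLimitP1 (ε : ℝ) (M K : ℕ) : ℝ :=
  1 / 2 * Real.logb 2
    (1 + Real.pi ^ 2 / 16 * (c.CLow ^ 2 / c.CSN ^ 2) * ((K : ℝ) / (M : ℝ) ^ 3) * (1 - ε))

end RelayConstants

/-- A network with `K` relays and `M` source-destination pairs: the received energies on the two
hops (within the uniform bounds), and the assignment `p` of relays to source-destination pairs,
which gives exactly `K / M` relays to each pair (so that `M` divides `K`). -/
structure RelayNetwork (c : RelayConstants) (K M : ℕ) where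
  E : Fin K → Fin M → ℝ
  P : Fin M → Fin K → ℝ
  p : Fin K → Fin M
  E_mem : ∀ k m, E k m ∈ Set.Icc c.Emin c.Emax
  P_mem : ∀ m k, P m k ∈ Set.Icc c.Pmin c.Pmax
  card_assigned : ∀ m, M * (Finset.univ.filter (fun k => p k = m)).card = K

/-- The phase factor `exp(j arg z)`. -/
def phaseFactor (z : ℂ) : ℂ := Complex.exp (Complex.I * (Complex.arg z : ℂ))

namespace RelayNetwork

variable {c : RelayConstants} {K M : ℕ} (N : RelayNetwork c K M)

/-- The energy normalization `d_{P1,k}` at relay `k`. -/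
def d (k : Fin K) : ℝ :=
  √c.Prel * (√((K : ℝ) / M * ∑ m, N.E k m + K * c.σ ^ 2))⁻¹

/-- The coefficient `C_{P1,k}^{m,m̂}`. -/
def coefC (m m' : Fin M) (k : Fin K) : ℝ :=
  √(K : ℝ) * N.d k * √(N.P m k * N.E k m')

/-- The coefficient `C_{P1,k}^m`. -/
def coefc (m : Fin M) (k : Fin K) : ℝ :=
  √(K : ℝ) * N.d k * √(N.P m k)

/-- The gain `a_k^{m,m̂}`, for the channel gains `h` (first hop) and `f` (second hop). -/
def a (h : Fin K → Fin M → ℂ) (f : Fin M → Fin K → ℂ) (m m' : Fin M) (k : Fin K) : ℂ :=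
  (N.coefC m m' k : ℂ) * star (phaseFactor (f (N.p k) k)) * f m k *
    star (phaseFactor (h k (N.p k))) * h k m'

/-- The noise gain `b_k^m`. -/
def b (h : Fin K → Fin M → ℂ) (f : Fin M → Fin K → ℂ) (m : Fin M) (k : Fin K) : ℂ :=
  (N.coefc m k : ℂ) * star (phaseFactor (f (N.p k) k)) * f m k *
    star (phaseFactor (h k (N.p k)))

/-- The effective signal-to-interference-plus-noise ratio of link `m` under protocol P1. -/
def SINR (h : Fin K → Fin M → ℂ) (f : Fin M → Fin K → ℂ) (m : Fin M) : ℝ :=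
  ‖∑ k, N.a h f m m k‖ ^ 2 /
    (∑ m' ∈ Finset.univ.erase m, ‖∑ k, N.a h f m m' k‖ ^ 2 +
      c.σ ^ 2 * M * ∑ k, ‖N.b h f m k‖ ^ 2 + K * M * c.σ ^ 2)

/-- The outage probability of link `m` at rate `R` (in bits), for random channel gains
`h` and `f` on the probability space `(Ω, μ)`. -/
def outageProb {Ω : Type*} [MeasurableSpace Ω] (μ : Measure Ω)
    (h : Fin K → Fin M → Ω → ℂ) (f : Fin M → Fin K → Ω → ℂ) (m : Fin M) (R : ℝ) : ℝ :=
  μ.real {ω | 1 / 2 * Real.logb 2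
    (1 + N.SINR (fun k m => h k m ω) (fun m k => f m k ω) m) ≤ R}

end RelayNetwork

/-- The channel gains of both hops are jointly independent, and each of them is `CN(0,1)`. -/
structure IsRayleighChannel {K M : ℕ} {Ω : Type*} [MeasurableSpace Ω] (μ : Measure Ω)
    (h : Fin K → Fin M → Ω → ℂ) (f : Fin M → Fin K → Ω → ℂ) : Prop where
  law_h : ∀ k m, HasLaw (h k m) (circGaussian 1) μ
  law_f : ∀ m k, HasLaw (f m k) (circGaussian 1) μ
  indep : iIndepFun
    (Sum.elim (fun q : Fin K × Fin M => h q.1 q.2) (fun q : Fin M × Fin K => f q.1 q.2)) μ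

end

/-! Relays assigned to the pair `m` cancel the phases of both hops, so their contributions to link
`m` add coherently: the amplitude is at least `CLow` times a sum of `K/M` products of Rayleigh
variables of mean `π/4`. All other contributions are conditionally complex Gaussian. If relay `k` is
not assigned to `m'`, the gain `h k m'` enters none of its phase factors; if it is assigned to `m' ≠
m`, the gain `f m k` enters none. Freezing the remaining coordinates leaves linear forms in
independent `CN(0,1)` variables, with variances controlled by sums of squared moduli of frozen
gains.

Chernoff bounds (`measure_sum_norm_sq_ge_le`, `measure_sum_norm_mul_norm_le`) and a union over `2M +
2` events show that some deviation exceeds `y` on its natural scale with probability at most `(2M +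
2) exp(1/2 - y/2)` (`measure_not_typical_le`). On the typical event the SINR estimate is
deterministic (`Typical.lt_SINR`), with `x = x(R)` as the common budget for all deviations;
`xP1_spec` says that this budget still leaves SINR above `2^(2R) - 1`. Put `L = Δ x^(2/7)` and `y =
2L + 1`. If `L ≥ 7`, the deviations fit into the budget (`scale_bounds`) and the outage probability
is at most `(2M + 2) exp(-L)`. If `L < 7`, the stated bound exceeds one.

For the limits, the back-off gives `1 - e ≥ ε`, and `M³ ≤ K` then gives `x ≥ κ √M`, so `L ≥ η
M^(1/7)`. This beats the factor `2M + 2` however fast `K` grows. The stated bound also carries `K²`,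
which is beaten if `log K = o(M^(1/7))`, or if the rates are bounded, because then `x` is at least a
power of `K`. -/

/-! ### Moments and exponential moments of `CN(0,1)`. -/

lemma lintegral_gaussianReal_half (F : ℝ → ENNReal) (hF : Measurable F) :
    ∫⁻ x, F x ∂gaussianReal 0 (1 / 2)
      = ∫⁻ x, ENNReal.ofReal ((√Real.pi)⁻¹ * Real.exp (-x ^ 2)) * F x := by
  rw [gaussianReal_of_var_ne_zero _ (by norm_num),
    lintegral_withDensity_eq_lintegral_mul _ (measurable_gaussianPDF _ _) hF]
  refine lintegral_congr fun x => ?_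
  have h : (2 : ℝ) * Real.pi * ((1 / 2 : ℝ≥0) : ℝ) = Real.pi := by push_cast; ring
  have h' : (2 : ℝ) * ((1 / 2 : ℝ≥0) : ℝ) = 1 := by push_cast; ring
  simp only [gaussianPDF, gaussianPDFReal_def, Pi.mul_apply, h, h', sub_zero, div_one]

lemma lintegral_circGaussian (F : ℂ → ENNReal) (hF : Measurable F) :
    ∫⁻ z, F z ∂circGaussian 1
      = ∫⁻ z, ENNReal.ofReal (Real.pi⁻¹ * Real.exp (-‖z‖ ^ 2)) * F z := by
  have hm : Measurable (fun q : ℝ × ℝ => (q.1 : ℂ) + (q.2 : ℂ) * Complex.I) := by fun_prop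
  rw [circGaussian, lintegral_map hF hm, lintegral_prod _ (by fun_prop),
    lintegral_gaussianReal_half _ (by fun_prop)]
  have h1 : ∀ x : ℝ, ∫⁻ y, F (x + y * Complex.I) ∂gaussianReal 0 (1 / 2)
      = ∫⁻ y : ℝ, ENNReal.ofReal ((√Real.pi)⁻¹ * Real.exp (-y ^ 2)) * F (x + y * Complex.I) :=
    fun x => lintegral_gaussianReal_half (fun y => F (x + y * Complex.I)) (by fun_prop)
  simp only [h1]
  rw [← Complex.volume_preserving_equiv_real_prod.symm.lintegral_comp (by fun_prop),
    Measure.volume_eq_prod, lintegral_prod _ (by fun_prop)]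
  refine lintegral_congr fun x => ?_
  rw [← lintegral_const_mul _ (by fun_prop)]
  refine lintegral_congr fun y => ?_
  have h2 : Complex.measurableEquivRealProd.symm (x, y) = (x : ℂ) + y * Complex.I := by
    rw [Complex.measurableEquivRealProd_symm_apply]
    exact Complex.mk_eq_add_mul_I x y
  rw [h2, ← mul_assoc, ← ENNReal.ofReal_mul (by positivity)]
  congr 2
  rw [← Complex.normSq_eq_norm_sq, Complex.normSq_add_mul_I]
  have : (√Real.pi)⁻¹ * (√Real.pi)⁻¹ = Real.pi⁻¹ := by
    rw [← mul_inv, Real.mul_self_sqrt Real.pi_pos.le]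
  rw [mul_mul_mul_comm, this, ← Real.exp_add]
  congr 2; ring

instance : IsProbabilityMeasure (circGaussian 1) := by
  unfold circGaussian
  exact Measure.isProbabilityMeasure_map (by fun_prop)

/-- A nonzero Bochner integral certifies integrability, since the integral of a non-integrable
function is zero by convention; hence the hypothesis `0 < v`. -/
lemma lintegral_ofReal_of_integral_pos {α : Type*} [MeasurableSpace α] {μ : Measure α}
    {f : α → ℝ} {v : ℝ} (hf : 0 ≤ f) (hv : 0 < v) (h : ∫ x, f x ∂μ = v) :
    ∫⁻ x, ENNReal.ofReal (f x) ∂μ = ENNReal.ofReal v := by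
  rw [← h, ofReal_integral_eq_lintegral_ofReal]
  · by_contra hc
    rw [integral_undef hc] at h
    exact hv.ne h
  · exact ae_of_all _ hf

lemma lintegral_circGaussian_exp_norm_sq {l : ℝ} (hl : l < 1) :
    ∫⁻ z, ENNReal.ofReal (Real.exp (l * ‖z‖ ^ 2)) ∂circGaussian 1
      = ENNReal.ofReal (1 / (1 - l)) := by
  rw [lintegral_circGaussian _ (by fun_prop)]
  have hl' : 0 < 1 - l := by linarith
  rw [← lintegral_ofReal_of_integral_pos (μ := volume)
    (f := fun z : ℂ => Real.pi⁻¹ * Real.exp (-(1 - l) * ‖z‖ ^ (2 : ℝ)))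
    (fun z => by positivity) (by positivity)]
  · refine lintegral_congr fun z => ?_
    rw [← ENNReal.ofReal_mul (by positivity), mul_assoc, ← Real.exp_add]
    congr 3
    rw [Real.rpow_two]; ring
  · rw [integral_const_mul, Complex.integral_exp_neg_mul_rpow (by norm_num) hl']
    rw [show (2 : ℝ) / 2 + 1 = 2 by norm_num, Real.Gamma_two,
      show (-2 : ℝ) / 2 = -1 by norm_num, Real.rpow_neg_one]
    field_simp

lemma lintegral_circGaussian_norm_rpow {q : ℝ} (hq : 0 < q) :
    ∫⁻ z, ENNReal.ofReal (‖z‖ ^ q) ∂circGaussian 1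
      = ENNReal.ofReal (Real.Gamma ((q + 2) / 2)) := by
  rw [lintegral_circGaussian _ (by fun_prop)]
  have := Real.Gamma_pos_of_pos (s := (q + 2) / 2) (by positivity)
  rw [← lintegral_ofReal_of_integral_pos (μ := volume)
    (f := fun z : ℂ => Real.pi⁻¹ * (‖z‖ ^ q * Real.exp (-1 * ‖z‖ ^ (2 : ℝ))))
    (fun z => by positivity) (by positivity)]
  · refine lintegral_congr fun z => ?_
    rw [← ENNReal.ofReal_mul (by positivity)]
    congr 1
    rw [Real.rpow_two]; ring_nf
  · rw [integral_const_mul, Complex.integral_rpow_mul_exp_neg_mul_rpow (by norm_num)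
      (by linarith) one_pos, Real.one_rpow]
    field_simp

lemma integrable_and_integral_of_lintegral {α : Type*} [MeasurableSpace α] {μ : Measure α}
    {f : α → ℝ} {v : ℝ} (hf : 0 ≤ f) (hm : Measurable f) (hv : 0 ≤ v)
    (h : ∫⁻ x, ENNReal.ofReal (f x) ∂μ = ENNReal.ofReal v) :
    Integrable f μ ∧ ∫ x, f x ∂μ = v := by
  constructor
  · refine ⟨hm.aestronglyMeasurable, ?_⟩
    rw [hasFiniteIntegral_iff_ofReal (ae_of_all _ hf), h]
    exact ENNReal.ofReal_lt_top
  · rw [integral_eq_lintegral_of_nonneg_ae (ae_of_all _ hf) hm.aestronglyMeasurable, h,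
      ENNReal.toReal_ofReal hv]

lemma circGaussian_norm_moment_one :
    Integrable (fun z : ℂ => ‖z‖) (circGaussian 1) ∧
      ∫ z : ℂ, ‖z‖ ∂circGaussian 1 = √Real.pi / 2 := by
  refine integrable_and_integral_of_lintegral (fun z => norm_nonneg z) measurable_norm
    (by positivity) ?_
  have h := lintegral_circGaussian_norm_rpow one_pos
  simp only [Real.rpow_one] at h
  rw [h, show ((1 : ℝ) + 2) / 2 = 1 / 2 + 1 by norm_num, Real.Gamma_add_one (by norm_num),
    Real.Gamma_one_half_eq]
  congr 1; ring

lemma circGaussian_norm_moment_two :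
    Integrable (fun z : ℂ => ‖z‖ ^ 2) (circGaussian 1) ∧
      ∫ z : ℂ, ‖z‖ ^ 2 ∂circGaussian 1 = 1 := by
  refine integrable_and_integral_of_lintegral (fun z => by positivity) (by fun_prop)
    (by positivity) ?_
  have h := lintegral_circGaussian_norm_rpow two_pos
  simp only [Real.rpow_two] at h
  rw [h, show ((2 : ℝ) + 2) / 2 = 2 by norm_num, Real.Gamma_two]

lemma lintegral_exp_gaussianReal_half (a : ℝ) :
    ∫⁻ x, ENNReal.ofReal (Real.exp (2 * a * x)) ∂gaussianReal 0 (1 / 2)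
      = ENNReal.ofReal (Real.exp (a ^ 2)) := by
  refine lintegral_ofReal_of_integral_pos (fun x => (Real.exp_pos _).le) (Real.exp_pos _) ?_
  have h := mgf_gaussianReal (p := gaussianReal 0 (1 / 2)) (X := id) Measure.map_id (2 * a)
  simp only [mgf, id] at h
  rw [h]
  congr 1
  push_cast; ring

/-- Read from right to left, this linearizes `exp(‖w‖²)`: it becomes an average of exponentials that
are real-linear in `w`. -/
lemma lintegral_circGaussian_exp_re (w : ℂ) :
    ∫⁻ z, ENNReal.ofReal (Real.exp (2 * (w * z).re)) ∂circGaussian 1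
      = ENNReal.ofReal (Real.exp (‖w‖ ^ 2)) := by
  rw [circGaussian, lintegral_map (by fun_prop) (by fun_prop)]
  have h : ∀ q : ℝ × ℝ, ENNReal.ofReal
      (Real.exp (2 * (w * ((q.1 : ℂ) + (q.2 : ℂ) * Complex.I)).re))
      = ENNReal.ofReal (Real.exp (2 * w.re * q.1)) *
        ENNReal.ofReal (Real.exp (2 * (-w.im) * q.2)) := by
    intro q
    rw [← ENNReal.ofReal_mul (Real.exp_pos _).le, ← Real.exp_add]
    congr 2
    simp; ring
  simp only [h]
  rw [lintegral_prod_mul (f := fun x => ENNReal.ofReal (Real.exp (2 * w.re * x)))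
    (g := fun x => ENNReal.ofReal (Real.exp (2 * (-w.im) * x))) (by fun_prop) (by fun_prop),
    lintegral_exp_gaussianReal_half, lintegral_exp_gaussianReal_half,
    ← ENNReal.ofReal_mul (Real.exp_pos _).le, ← Real.exp_add, ← Complex.normSq_eq_norm_sq,
    Complex.normSq_apply]
  congr 2; ring

/-- Because `(1 - u + u²/2)(1 + u + u²/2) = 1 + u⁴/4 ≥ 1`. -/
lemma exp_neg_le_quadratic {u : ℝ} (hu : 0 ≤ u) : Real.exp (-u) ≤ 1 - u + u ^ 2 / 2 := by
  have h : 1 + u + u ^ 2 / 2 ≤ Real.exp u := Real.quadratic_le_exp_of_nonneg hu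
  rw [Real.exp_neg, inv_le_comm₀ (Real.exp_pos _) (by nlinarith [sq_nonneg (u - 1)])]
  refine le_trans ?_ h
  rw [inv_le_iff_one_le_mul₀ (by nlinarith [sq_nonneg (u - 1)])]
  nlinarith [sq_nonneg (u ^ 2)]

/-- The quadratic bound on `exp(-u)` needs only the mean `(√π/2)² = π/4` and the second moment `1`
of the product; `1 + t ≤ exp t` restores exponential form. -/
lemma lintegral_exp_neg_mul_norm_mul_norm {l : ℝ} (hl : 0 ≤ l) :
    ∫⁻ z, ∫⁻ w, ENNReal.ofReal (Real.exp (-(l * (‖z‖ * ‖w‖)))) ∂circGaussian 1 ∂circGaussian 1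
      ≤ ENNReal.ofReal (Real.exp (-(l * (Real.pi / 4)) + l ^ 2 / 2)) := by
  rw [← lintegral_prod (fun q : ℂ × ℂ => ENNReal.ofReal (Real.exp (-(l * (‖q.1‖ * ‖q.2‖)))))
    (by fun_prop)]
  obtain ⟨i1, e1⟩ := circGaussian_norm_moment_one
  obtain ⟨i2, e2⟩ := circGaussian_norm_moment_two
  have I1 := i1.mul_prod i1
  have I2 := i2.mul_prod i2
  have E1 := integral_prod_mul (μ := circGaussian 1) (ν := circGaussian 1)
    (fun z : ℂ => ‖z‖) (fun z : ℂ => ‖z‖)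
  have E2 := integral_prod_mul (μ := circGaussian 1) (ν := circGaussian 1)
    (fun z : ℂ => ‖z‖ ^ 2) (fun z : ℂ => ‖z‖ ^ 2)
  rw [e1] at E1
  rw [e2] at E2
  have I3 : Integrable (fun q : ℂ × ℂ => 1 - l * (‖q.1‖ * ‖q.2‖))
      ((circGaussian 1).prod (circGaussian 1)) := (integrable_const _).sub (I1.const_mul l)
  have I4 : Integrable (fun q : ℂ × ℂ => (1 - l * (‖q.1‖ * ‖q.2‖))
      + l ^ 2 / 2 * (‖q.1‖ ^ 2 * ‖q.2‖ ^ 2)) ((circGaussian 1).prod (circGaussian 1)) :=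
    I3.add (I2.const_mul (l ^ 2 / 2))
  have hle : ∀ q : ℂ × ℂ, Real.exp (-(l * (‖q.1‖ * ‖q.2‖))) ≤ (1 - l * (‖q.1‖ * ‖q.2‖))
      + l ^ 2 / 2 * (‖q.1‖ ^ 2 * ‖q.2‖ ^ 2) := fun q => by
    refine (exp_neg_le_quadratic (by positivity)).trans (le_of_eq ?_)
    ring
  calc _ ≤ ∫⁻ q : ℂ × ℂ, ENNReal.ofReal ((1 - l * (‖q.1‖ * ‖q.2‖))
      + l ^ 2 / 2 * (‖q.1‖ ^ 2 * ‖q.2‖ ^ 2)) ∂((circGaussian 1).prod (circGaussian 1)) :=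
        lintegral_mono fun q => ENNReal.ofReal_le_ofReal (hle q)
    _ = ENNReal.ofReal (1 - l * (√Real.pi / 2 * (√Real.pi / 2)) + l ^ 2 / 2 * (1 * 1)) := by
        rw [← ofReal_integral_eq_lintegral_ofReal I4
          (ae_of_all _ fun q => (Real.exp_pos _).le.trans (hle q)),
          integral_add I3 (I2.const_mul (l ^ 2 / 2)),
          integral_sub (integrable_const _) (I1.const_mul l), integral_const_mul,
          integral_const_mul, E1, E2]
        simp
    _ ≤ _ := by
        apply ENNReal.ofReal_le_ofReal
        have h := Real.add_one_le_exp (-(l * (Real.pi / 4)) + l ^ 2 / 2)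
        have h2 := Real.mul_self_sqrt Real.pi_pos.le
        nlinarith

/-! ### Conditioning by resampling, and Chernoff bounds for Gaussian families. -/

/-- The law of a family of independent `CN(0,1)` variables. -/
noncomputable abbrev gaussianFamily (ι : Type*) [Fintype ι] : Measure (ι → ℂ) :=
  Measure.pi fun _ => circGaussian 1

section
variable {ι κ : Type*} [Fintype ι]

lemma measurePreserving_piecewise [DecidableEq ι] (S : Finset ι) :
    MeasurePreserving (fun q : (ι → ℂ) × (ι → ℂ) => S.piecewise q.1 q.2)
      ((gaussianFamily ι).prod (gaussianFamily ι)) (gaussianFamily ι) := by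
  have hm : Measurable (fun q : (ι → ℂ) × (ι → ℂ) => S.piecewise q.1 q.2) := by
    refine measurable_pi_lambda _ fun i => ?_
    by_cases hi : i ∈ S <;> simp only [Finset.piecewise, hi, if_true, if_false] <;> fun_prop
  refine ⟨hm, (Measure.pi_eq fun s hs => ?_).symm⟩
  rw [Measure.map_apply hm (MeasurableSet.univ_pi hs)]
  have h : (fun q : (ι → ℂ) × (ι → ℂ) => S.piecewise q.1 q.2) ⁻¹' Set.univ.pi s
      = (Set.univ.pi fun i => if i ∈ S then s i else Set.univ) ×ˢ
        (Set.univ.pi fun i => if i ∈ S then Set.univ else s i) := by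
    ext q
    simp only [Set.mem_preimage, Set.mem_univ_pi, Set.mem_prod, ← forall_and]
    refine forall_congr' fun i => ?_
    by_cases hi : i ∈ S <;> simp [Finset.piecewise, hi]
  rw [h, Measure.prod_prod, Measure.pi_pi, Measure.pi_pi, ← Finset.prod_mul_distrib]
  refine Finset.prod_congr rfl fun i _ => ?_
  by_cases hi : i ∈ S <;> simp [hi]

/-- This replaces conditional expectation: the inner integral runs over the coordinates in `S` while
those outside `S` stay frozen at `b`. -/
lemma lintegral_resample [DecidableEq ι] (S : Finset ι) {F : (ι → ℂ) → ENNReal}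
    (hF : Measurable F) :
    ∫⁻ x, F x ∂gaussianFamily ι
      = ∫⁻ b, ∫⁻ a, F (S.piecewise a b) ∂gaussianFamily ι ∂gaussianFamily ι := by
  have h := measurePreserving_piecewise S
  rw [← h.lintegral_comp hF, lintegral_prod_symm]
  exact (hF.comp h.measurable).aemeasurable

lemma lintegral_prod_gaussianFamily {u : κ → ι} (hu : Function.Injective u) (s : Finset κ)
    {F : κ → ℂ → ENNReal} (hF : ∀ k, Measurable (F k)) :
    ∫⁻ x, ∏ k ∈ s, F k (x (u k)) ∂gaussianFamily ι = ∏ k ∈ s, ∫⁻ z, F k z ∂circGaussian 1 := by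
  have h0 : iIndepFun (fun (i : ι) (x : ι → ℂ) => x i) (gaussianFamily ι) :=
    iIndepFun_pi (μ := fun _ : ι => circGaussian 1) (X := fun _ z => z)
      fun _ => aemeasurable_id
  have h1 : iIndepFun (fun (k : κ) (x : ι → ℂ) => F k (x (u k))) (gaussianFamily ι) :=
    (h0.precomp hu).comp F hF
  rw [lintegral_prod_eq_prod_lintegral_of_indepFun s _ h1
    fun k => (hF k).comp (measurable_pi_apply _)]
  refine Finset.prod_congr rfl fun k _ => ?_
  exact (measurePreserving_eval (fun _ : ι => circGaussian 1) (u k)).lintegral_comp (hF k)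

lemma ofReal_exp_sum (s : Finset κ) (f : κ → ℝ) :
    ∏ k ∈ s, ENNReal.ofReal (Real.exp (f k)) = ENNReal.ofReal (Real.exp (∑ k ∈ s, f k)) := by
  rw [Real.exp_sum, ENNReal.ofReal_prod_of_nonneg fun k _ => (Real.exp_pos _).le]

/-- An auxiliary Gaussian `g j` for each group turns the squared moduli into forms linear in `x`.
After exchanging the integrals, the integral over `x` factorizes and costs at most `exp(l ‖g j‖²)`
per group; integrating over `g` gives `1/(1 - l)` each. No density of the linear forms is needed. -/
lemma lintegral_exp_sum_norm_sq_linear_le [Fintype κ] [DecidableEq κ] (J : Finset κ) (τ : ι → κ)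
    (c : ι → ℂ) (hc : ∀ j ∈ J, ∑ i with τ i = j, ‖c i‖ ^ 2 ≤ 1) {l : ℝ} (hl : 0 ≤ l)
    (hl1 : l < 1) :
    ∫⁻ x, ENNReal.ofReal (Real.exp (l * ∑ j ∈ J, ‖∑ i with τ i = j, c i * x i‖ ^ 2))
      ∂gaussianFamily ι ≤ ENNReal.ofReal (1 / (1 - l)) ^ J.card := by
  have hs : √l ^ 2 = l := Real.sq_sqrt hl
  have step1 : ∀ x : ι → ℂ,
      ENNReal.ofReal (Real.exp (l * ∑ j ∈ J, ‖∑ i with τ i = j, c i * x i‖ ^ 2))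
      = ∫⁻ g, ∏ j ∈ J, ENNReal.ofReal
        (Real.exp (2 * ((√l * ∑ i with τ i = j, c i * x i) * g j).re)) ∂gaussianFamily κ := by
    intro x
    rw [lintegral_prod_gaussianFamily (u := fun i => i) (fun _ _ h => h) J
      (F := fun j z => ENNReal.ofReal
        (Real.exp (2 * ((√l * ∑ i with τ i = j, c i * x i) * z).re))) (fun j => by fun_prop)]
    simp only [lintegral_circGaussian_exp_re]
    rw [ofReal_exp_sum, Finset.mul_sum]
    simp only [norm_mul, mul_pow, Complex.norm_real, Real.norm_eq_abs, sq_abs, hs]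
  have step3 : ∀ g : κ → ℂ, ∫⁻ x, ∏ j ∈ J, ENNReal.ofReal
        (Real.exp (2 * ((√l * ∑ i with τ i = j, c i * x i) * g j).re)) ∂gaussianFamily ι
      ≤ ∏ j ∈ J, ENNReal.ofReal (Real.exp (l * ‖g j‖ ^ 2)) := by
    intro g
    have e : ∀ x : ι → ℂ, ∏ j ∈ J, ENNReal.ofReal
        (Real.exp (2 * ((√l * ∑ i with τ i = j, c i * x i) * g j).re))
        = ∏ i with τ i ∈ J, ENNReal.ofReal (Real.exp (2 * ((√l * g (τ i) * c i) * x i).re)) := by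
      intro x
      rw [← Finset.prod_fiberwise_of_maps_to (s := Finset.univ.filter fun i => τ i ∈ J) (t := J)
        (g := τ) (fun i hi => (Finset.mem_filter.1 hi).2)]
      refine Finset.prod_congr rfl fun j hj => ?_
      have hf : (Finset.univ.filter fun i => τ i ∈ J).filter (fun i => τ i = j)
          = Finset.univ.filter fun i => τ i = j := by
        ext i
        simp only [Finset.mem_filter, Finset.mem_univ, true_and, and_iff_right_iff_imp]
        rintro rfl; exact hj
      rw [hf, ofReal_exp_sum, ← Finset.mul_sum, ← Complex.re_sum, Finset.mul_sum, Finset.sum_mul]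
      congr 4
      refine Finset.sum_congr rfl fun i hi => ?_
      rw [(Finset.mem_filter.1 hi).2]; ring
    simp only [e]
    rw [lintegral_prod_gaussianFamily (u := fun i => i) (fun _ _ h => h) _
      (F := fun i z => ENNReal.ofReal
        (Real.exp (2 * ((√l * g (τ i) * c i) * z).re))) (fun j => by fun_prop)]
    simp only [lintegral_circGaussian_exp_re]
    rw [ofReal_exp_sum, ofReal_exp_sum]
    refine ENNReal.ofReal_le_ofReal (Real.exp_le_exp.2 ?_)
    rw [← Finset.sum_fiberwise_of_maps_to (s := Finset.univ.filter fun i => τ i ∈ J) (t := J)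
        (g := τ) (fun i hi => (Finset.mem_filter.1 hi).2)]
    refine Finset.sum_le_sum fun j hj => ?_
    have hf : (Finset.univ.filter fun i => τ i ∈ J).filter (fun i => τ i = j)
        = Finset.univ.filter fun i => τ i = j := by
      ext i
      simp only [Finset.mem_filter, Finset.mem_univ, true_and, and_iff_right_iff_imp]
      rintro rfl; exact hj
    rw [hf]
    calc _ = l * ‖g j‖ ^ 2 * ∑ i with τ i = j, ‖c i‖ ^ 2 := by
          rw [Finset.mul_sum]
          refine Finset.sum_congr rfl fun i hi => ?_
          rw [(Finset.mem_filter.1 hi).2]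
          simp only [norm_mul, mul_pow, Complex.norm_real, Real.norm_eq_abs, sq_abs, hs]
      _ ≤ l * ‖g j‖ ^ 2 * 1 := mul_le_mul_of_nonneg_left (hc j hj) (by positivity)
      _ = _ := mul_one _
  simp only [step1]
  rw [lintegral_lintegral_swap (by fun_prop)]
  refine (lintegral_mono step3).trans ?_
  rw [lintegral_prod_gaussianFamily (u := fun i => i) (fun _ _ h => h) J
    (F := fun _ z => ENNReal.ofReal (Real.exp (l * ‖z‖ ^ 2))) (fun j => by fun_prop)]
  simp [lintegral_circGaussian_exp_norm_sq hl1]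

/-- The coefficients depend only on coordinates outside `S` and multiply only coordinates in `S`, so
freezing the outside reduces to constant coefficients. -/
lemma lintegral_exp_sum_norm_sq_le [DecidableEq ι] [Fintype κ] [DecidableEq κ] (S : Finset ι)
    (J : Finset κ) (τ : ι → κ) (c : (ι → ℂ) → ι → ℂ) (hm : ∀ i, Measurable fun x => c x i)
    (hS : ∀ x, ∀ i ∉ S, c x i = 0) (hdep : ∀ a b, c (S.piecewise a b) = c b)
    (hc : ∀ x, ∀ j ∈ J, ∑ i with τ i = j, ‖c x i‖ ^ 2 ≤ 1) {l : ℝ} (hl : 0 ≤ l) (hl1 : l < 1) :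
    ∫⁻ x, ENNReal.ofReal (Real.exp (l * ∑ j ∈ J, ‖∑ i with τ i = j, c x i * x i‖ ^ 2))
      ∂gaussianFamily ι ≤ ENNReal.ofReal (1 / (1 - l)) ^ J.card := by
  rw [lintegral_resample S (by fun_prop)]
  calc _ ≤ ∫⁻ _ : ι → ℂ, ENNReal.ofReal (1 / (1 - l)) ^ J.card ∂gaussianFamily ι := by
        refine lintegral_mono fun b => ?_
        refine le_trans (le_of_eq (lintegral_congr fun a => ?_))
          (lintegral_exp_sum_norm_sq_linear_le J τ (c b) (hc b) hl hl1)
        simp only [hdep]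
        congr 3
        refine Finset.sum_congr rfl fun j _ => ?_
        congr 2
        refine Finset.sum_congr rfl fun i _ => ?_
        by_cases hi : i ∈ S
        · simp [Finset.piecewise, hi]
        · simp [hS b i hi]
    _ = _ := by simp

lemma one_div_one_sub_le_exp {l : ℝ} (hl : 0 ≤ l) (hl1 : l ≤ 1 / 2) :
    1 / (1 - l) ≤ Real.exp (l + l ^ 2) := by
  refine le_trans ?_ (Real.quadratic_le_exp_of_nonneg (by positivity))
  rw [div_le_iff₀ (by linarith)]
  -- With `t = l + l²`, the excess `(1 - l)(1 + t + t²/2) - 1` equals `(l²/2)(1 - l - l² - l³)`.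
  have h : 0 ≤ 1 - l - l ^ 2 - l ^ 3 := by
    nlinarith [mul_nonneg (sq_nonneg l) (sub_nonneg.2 hl1), mul_nonneg hl (sub_nonneg.2 hl1)]
  nlinarith [mul_nonneg (sq_nonneg l) h]

lemma measure_exp_markov {α : Type*} [MeasurableSpace α] {μ : Measure α} {Y : α → ℝ} {t B : ℝ}
    (hY : Measurable Y)
    (h : ∫⁻ x, ENNReal.ofReal (Real.exp (Y x)) ∂μ ≤ ENNReal.ofReal (Real.exp B)) :
    μ {x | t ≤ Y x} ≤ ENNReal.ofReal (Real.exp (B - t)) := by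
  have h1 := meas_ge_le_lintegral_div (μ := μ) (f := fun x => ENNReal.ofReal (Real.exp (Y x)))
    (by fun_prop) (ε := ENNReal.ofReal (Real.exp t)) (by simp [Real.exp_pos]) (by simp)
  calc μ {x | t ≤ Y x} ≤ μ {x | ENNReal.ofReal (Real.exp t) ≤ ENNReal.ofReal (Real.exp (Y x))} :=
        measure_mono fun x hx => ENNReal.ofReal_le_ofReal (Real.exp_le_exp.2 hx)
    _ ≤ ENNReal.ofReal (Real.exp B) / ENNReal.ofReal (Real.exp t) :=
        h1.trans (ENNReal.div_le_div_right h _)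
    _ = _ := by rw [← ENNReal.ofReal_div_of_pos (Real.exp_pos _), Real.exp_sub]

/-- Upper tail of a sum of squared moduli of conditionally Gaussian linear forms in disjoint
groups of variables, each of conditional variance at most one. -/
lemma measure_sum_norm_sq_ge_le [DecidableEq ι] [Fintype κ] [DecidableEq κ] (S : Finset ι)
    (J : Finset κ) (τ : ι → κ) (c : (ι → ℂ) → ι → ℂ) (hm : ∀ i, Measurable fun x => c x i)
    (hS : ∀ x, ∀ i ∉ S, c x i = 0) (hdep : ∀ a b, c (S.piecewise a b) = c b)
    (hc : ∀ x, ∀ j ∈ J, ∑ i with τ i = j, ‖c x i‖ ^ 2 ≤ 1) {n : ℝ} (hn : 1 ≤ n)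
    (hJ : (J.card : ℝ) ≤ n) (y : ℝ) :
    gaussianFamily ι {x | J.card + √n * y ≤ ∑ j ∈ J, ‖∑ i with τ i = j, c x i * x i‖ ^ 2}
      ≤ ENNReal.ofReal (Real.exp (1 / 4 - y / 2)) := by
  have hsn : 1 ≤ √n := Real.one_le_sqrt.2 hn
  have hsq : √n ^ 2 = n := Real.sq_sqrt (by linarith)
  -- With this `l`, the threshold contributes `J.card * l + y/2`; its first term cancels the linear
  -- term of the exponential moment, and the quadratic term costs at most `1/4`.
  set l : ℝ := 1 / (2 * √n) with hl
  have hl0 : 0 < l := by positivity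
  have hl2 : l ≤ 1 / 2 := by
    rw [hl]; exact one_div_le_one_div_of_le (by norm_num) (by linarith)
  have hln : l * √n = 1 / 2 := by rw [hl]; field_simp
  have hlJ : J.card * l ^ 2 ≤ 1 / 4 := by
    calc J.card * l ^ 2 ≤ n * l ^ 2 := by gcongr
      _ = (l * √n) ^ 2 := by rw [mul_pow, hsq]; ring
      _ = 1 / 4 := by rw [hln]; norm_num
  have h1 := lintegral_exp_sum_norm_sq_le S J τ c hm hS hdep hc hl0.le (by linarith)
  have h2 : ENNReal.ofReal (1 / (1 - l)) ^ J.card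
      ≤ ENNReal.ofReal (Real.exp (J.card * (l + l ^ 2))) := by
    rw [← ENNReal.ofReal_pow (by apply div_nonneg <;> linarith), Real.exp_nat_mul]
    exact ENNReal.ofReal_le_ofReal (pow_le_pow_left₀ (by apply div_nonneg <;> linarith)
      (one_div_one_sub_le_exp hl0.le hl2) _)
  refine (measure_mono ?_).trans ((measure_exp_markov (t := l * (J.card + √n * y)) (by fun_prop)
    (h1.trans h2)).trans (ENNReal.ofReal_le_ofReal (Real.exp_le_exp.2 ?_)))
  · intro x hx
    exact mul_le_mul_of_nonneg_left hx hl0.le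
  · have : l * (J.card + √n * y) = J.card * l + y / 2 := by
      rw [mul_add, ← mul_assoc l, hln]; ring
    rw [this]; linarith

/-- Lower tail of a sum of products of independent Rayleigh variables. -/
lemma measure_sum_norm_mul_norm_le [DecidableEq ι] (A : Finset κ) {u v : κ → ι}
    (hu : Function.Injective u) (hv : Function.Injective v) (S : Finset ι) (huS : ∀ k, u k ∈ S)
    (hvS : ∀ k, v k ∉ S) {n : ℝ} (hn : 1 ≤ n) (hA : (A.card : ℝ) ≤ n) (y : ℝ) :
    gaussianFamily ι {x | ∑ k ∈ A, ‖x (u k)‖ * ‖x (v k)‖ ≤ A.card * (Real.pi / 4) - √n * y}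
      ≤ ENNReal.ofReal (Real.exp (1 / 2 - y)) := by
  have hsn : 0 < √n := Real.sqrt_pos.2 (by linarith)
  have hsq : √n ^ 2 = n := Real.sq_sqrt (by linarith)
  -- Here `l √n y = y`, and the quadratic term `A.card * l²/2` costs at most `1/2`.
  set l : ℝ := 1 / √n with hl
  have hl0 : 0 < l := by positivity
  have hln : l * √n = 1 := by rw [hl]; field_simp
  have hlJ : A.card * l ^ 2 ≤ 1 := by
    calc A.card * l ^ 2 ≤ n * l ^ 2 := by gcongr
      _ = (l * √n) ^ 2 := by rw [mul_pow, hsq]; ring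
      _ = 1 := by rw [hln]; norm_num
  have h1 : ∫⁻ x, ENNReal.ofReal (Real.exp (∑ k ∈ A, -(l * (‖x (u k)‖ * ‖x (v k)‖))))
      ∂gaussianFamily ι
      ≤ ENNReal.ofReal (Real.exp (A.card * (-(l * (Real.pi / 4)) + l ^ 2 / 2))) := by
    rw [lintegral_resample S (by fun_prop)]
    -- With the `v`-coordinates frozen, the integral over the `u`-coordinates factorizes over `k`;
    -- the outer integral over the `v`-coordinates then factorizes as well.
    have e : ∀ b : ι → ℂ, ∫⁻ a, ENNReal.ofReal (Real.exp (∑ k ∈ A,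
        -(l * (‖S.piecewise a b (u k)‖ * ‖S.piecewise a b (v k)‖)))) ∂gaussianFamily ι
        = ∏ k ∈ A, ∫⁻ z, ENNReal.ofReal (Real.exp (-(l * (‖z‖ * ‖b (v k)‖)))) ∂circGaussian 1 := by
      intro b
      rw [← lintegral_prod_gaussianFamily hu A
        (F := fun k z => ENNReal.ofReal (Real.exp (-(l * (‖z‖ * ‖b (v k)‖)))))
        (fun k => by fun_prop)]
      refine lintegral_congr fun a => ?_
      rw [ofReal_exp_sum]
      simp [Finset.piecewise, huS, hvS]
    simp only [e]
    rw [lintegral_prod_gaussianFamily hv A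
      (F := fun k w => ∫⁻ z, ENNReal.ofReal (Real.exp (-(l * (‖z‖ * ‖w‖)))) ∂circGaussian 1)
      (fun k => Measurable.lintegral_prod_right' (f := fun q : ℂ × ℂ =>
        ENNReal.ofReal (Real.exp (-(l * (‖q.2‖ * ‖q.1‖))))) (by fun_prop)), Finset.prod_const,
      Real.exp_nat_mul, ENNReal.ofReal_pow (Real.exp_pos _).le]
    refine pow_le_pow_left₀ (zero_le) ?_ _
    refine le_trans (le_of_eq ?_) (lintegral_exp_neg_mul_norm_mul_norm hl0.le)
    exact lintegral_congr fun w => lintegral_congr fun z => by rw [mul_comm ‖z‖]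
  refine (measure_mono ?_).trans ((measure_exp_markov
    (t := -(l * (A.card * (Real.pi / 4) - √n * y))) (by fun_prop)
    h1).trans (ENNReal.ofReal_le_ofReal (Real.exp_le_exp.2 ?_)))
  · intro x hx
    rw [Set.mem_ofPred_eq, Finset.sum_neg_distrib, ← Finset.mul_sum]
    exact neg_le_neg (mul_le_mul_of_nonneg_left hx hl0.le)
  · have : l * (A.card * (Real.pi / 4) - √n * y) = A.card * (l * (Real.pi / 4)) - y := by
      rw [mul_sub, ← mul_assoc l (√n), hln]; ring
    rw [this]; nlinarith

end

/-! ### Phase factors and uniform bounds on the coefficients. -/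

lemma norm_phaseFactor (z : ℂ) : ‖phaseFactor z‖ = 1 := by
  rw [phaseFactor, mul_comm, Complex.norm_exp_ofReal_mul_I]

lemma star_phaseFactor_mul_self (z : ℂ) : star (phaseFactor z) * z = ‖z‖ := by
  have h : phaseFactor z * (‖z‖ : ℂ) = z := by
    rw [phaseFactor, mul_comm, mul_comm Complex.I]
    exact Complex.norm_mul_exp_arg_mul_I z
  have h1 : star (phaseFactor z) * phaseFactor z = 1 := by
    have := Complex.normSq_eq_conj_mul_self (z := phaseFactor z)
    rw [Complex.normSq_eq_norm_sq, norm_phaseFactor] at this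
    rw [Complex.star_def, ← this]; norm_num
  calc star (phaseFactor z) * z = star (phaseFactor z) * (phaseFactor z * ‖z‖) := by rw [h]
    _ = ‖z‖ := by rw [← mul_assoc, h1, one_mul]

@[fun_prop]
lemma measurable_phaseFactor : Measurable phaseFactor := by
  unfold phaseFactor
  fun_prop

namespace RelayConstants
variable (c : RelayConstants)

lemma Emax_pos : 0 < c.Emax := c.Emin_pos.trans_le c.Emin_le_Emax
lemma Pmax_pos : 0 < c.Pmax := c.Pmin_pos.trans_le c.Pmin_le_Pmax

lemma CLow_pos : 0 < c.CLow := by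
  have := c.Emin_pos; have := c.Emax_pos; have := c.Pmin_pos; have := c.Prel_pos
  have := c.σ_pos
  exact Real.sqrt_pos.2 (by positivity)

lemma CUp_pos : 0 < c.CUp := by
  have := c.Emin_pos; have := c.Emax_pos; have := c.Pmax_pos; have := c.Prel_pos
  have := c.σ_pos
  exact Real.sqrt_pos.2 (by positivity)

lemma cUp_pos : 0 < c.cUp := by
  have := c.Emin_pos; have := c.Pmax_pos; have := c.Prel_pos
  have := c.σ_pos
  exact Real.sqrt_pos.2 (by positivity)

lemma CSN_pos : 0 < c.CSN := by
  have := c.CUp_pos; have := c.σ_pos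
  exact Real.sqrt_pos.2 (by positivity)

lemma CSN_sq : c.CSN ^ 2 = c.CUp ^ 2 + c.σ ^ 2 * (c.cUp ^ 2 + 1) :=
  Real.sq_sqrt (by positivity)

lemma CLow_le_CUp : c.CLow ≤ c.CUp := by
  have := c.Emin_pos; have := c.Emax_pos; have := c.Pmin_pos; have := c.Prel_pos
  have := c.Pmax_pos; have := c.σ_pos; have := c.Emin_le_Emax; have := c.Pmin_le_Pmax
  unfold CLow CUp
  gcongr

end RelayConstants

namespace RelayNetwork
variable {c : RelayConstants} {K M : ℕ} (N : RelayNetwork c K M)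

lemma numPairs_pos (N : RelayNetwork c K M) (hK : 0 < K) : 0 < M := by
  rcases Nat.eq_zero_or_pos M with rfl | h
  · exact (N.p ⟨0, hK⟩).elim0
  · exact h

/-- The normalized squared relay gain `K d_k² = P_rel / (E̅ + σ²)`, `E̅` the average energy. -/
lemma mul_d_sq_bounds (k : Fin K) :
    c.Prel / (c.Emax + c.σ ^ 2) ≤ (√(K : ℝ) * N.d k) ^ 2 ∧
      (√(K : ℝ) * N.d k) ^ 2 ≤ c.Prel / (c.Emin + c.σ ^ 2) := by
  have hK : 0 < K := k.pos
  have hM : (0 : ℝ) < M := by exact_mod_cast N.numPairs_pos hK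
  have hK' : (0 : ℝ) < K := by exact_mod_cast hK
  have hE := c.Emin_pos
  have hσ := c.σ_pos
  have hP := c.Prel_pos
  have l1 : (M : ℝ) * c.Emin ≤ ∑ m, N.E k m := by
    have := Finset.card_nsmul_le_sum Finset.univ (fun m => N.E k m) c.Emin
      fun m _ => (N.E_mem k m).1
    simpa using this
  have l2 : ∑ m, N.E k m ≤ (M : ℝ) * c.Emax := by
    have := Finset.sum_le_card_nsmul Finset.univ (fun m => N.E k m) c.Emax
      fun m _ => (N.E_mem k m).2
    simpa using this
  have e : (√(K : ℝ) * N.d k) ^ 2 = c.Prel / ((∑ m, N.E k m) / M + c.σ ^ 2) := by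
    have hs : 0 < ∑ m, N.E k m := lt_of_lt_of_le (by positivity) l1
    rw [d, mul_pow, mul_pow, inv_pow, Real.sq_sqrt hK'.le, Real.sq_sqrt hP.le,
      Real.sq_sqrt (by positivity)]
    field_simp
  have hs1 : c.Emin ≤ (∑ m, N.E k m) / M := by rw [le_div_iff₀ hM]; linarith
  have hs2 : (∑ m, N.E k m) / M ≤ c.Emax := by rw [div_le_iff₀ hM]; linarith
  have hs3 : 0 < (∑ m, N.E k m) / M := hE.trans_le hs1
  rw [e]
  constructor <;> gcongr

lemma d_nonneg (k : Fin K) : 0 ≤ N.d k := by unfold d; positivity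

lemma coefC_nonneg (m m' : Fin M) (k : Fin K) : 0 ≤ N.coefC m m' k :=
  mul_nonneg (mul_nonneg (Real.sqrt_nonneg _) (N.d_nonneg k)) (Real.sqrt_nonneg _)

lemma coefc_nonneg (m : Fin M) (k : Fin K) : 0 ≤ N.coefc m k :=
  mul_nonneg (mul_nonneg (Real.sqrt_nonneg _) (N.d_nonneg k)) (Real.sqrt_nonneg _)

lemma E_pos (k : Fin K) (m : Fin M) : 0 < N.E k m := c.Emin_pos.trans_le (N.E_mem k m).1
lemma P_pos (m : Fin M) (k : Fin K) : 0 < N.P m k := c.Pmin_pos.trans_le (N.P_mem m k).1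

lemma CLow_le_coefC (m m' : Fin M) (k : Fin K) : c.CLow ≤ N.coefC m m' k := by
  refine Real.sqrt_le_iff.2 ⟨N.coefC_nonneg m m' k, ?_⟩
  have h := (N.mul_d_sq_bounds k).1
  have := c.Emin_pos; have := c.Pmin_pos; have := N.E_pos k m'; have := N.P_pos m k
  rw [coefC, mul_pow, Real.sq_sqrt (by positivity)]
  calc _ = c.Prel / (c.Emax + c.σ ^ 2) * (c.Pmin * c.Emin) := by ring
    _ ≤ _ := by
      have h1 := (N.E_mem k m').1
      have h2 := (N.P_mem m k).1
      gcongr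

lemma coefC_le_CUp (m m' : Fin M) (k : Fin K) : N.coefC m m' k ≤ c.CUp := by
  refine Real.le_sqrt_of_sq_le ?_
  have h := (N.mul_d_sq_bounds k).2
  have := c.Prel_pos; have := c.σ_pos
  have := c.Emin_pos; have := c.Pmin_pos; have := N.E_pos k m'; have := N.P_pos m k
  rw [coefC, mul_pow, Real.sq_sqrt (by positivity)]
  have h1 := (N.E_mem k m').2
  have h2 := (N.P_mem m k).2
  have := c.Pmax_pos
  calc _ ≤ c.Prel / (c.Emin + c.σ ^ 2) * (c.Pmax * c.Emax) := by gcongr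
    _ = _ := by ring

lemma coefc_le_cUp (m : Fin M) (k : Fin K) : N.coefc m k ≤ c.cUp := by
  refine Real.le_sqrt_of_sq_le ?_
  have h := (N.mul_d_sq_bounds k).2
  have := c.Prel_pos; have := c.σ_pos
  have := c.Emin_pos; have := c.Pmin_pos; have := N.P_pos m k
  rw [coefc, mul_pow, Real.sq_sqrt (by positivity)]
  have h2 := (N.P_mem m k).2
  calc _ ≤ c.Prel / (c.Emin + c.σ ^ 2) * c.Pmax := by gcongr
    _ = _ := by ring

/-! ### Splitting the gains by assignment, and tail bounds for each part. -/

/-- The relays assigned to the pair `m`. -/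
def relays (m : Fin M) : Finset (Fin K) := Finset.univ.filter fun k => N.p k = m

/-- The part of the gain of `m' → m` that is due to relays not assigned to `m'`. -/
noncomputable def gainUnassigned (h : Fin K → Fin M → ℂ) (f : Fin M → Fin K → ℂ)
    (m m' : Fin M) : ℂ :=
  ∑ k with N.p k ≠ m', N.a h f m m' k

/-- The part of the gain of `m' → m` that is due to the relays assigned to `m'`. -/
noncomputable def gainAssigned (h : Fin K → Fin M → ℂ) (f : Fin M → Fin K → ℂ) (m m' : Fin M) : ℂ :=
  ∑ k ∈ N.relays m', N.a h f m m' k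

lemma sum_a_eq (h : Fin K → Fin M → ℂ) (f : Fin M → Fin K → ℂ) (m m' : Fin M) :
    ∑ k, N.a h f m m' k = N.gainAssigned h f m m' + N.gainUnassigned h f m m' :=
  (Finset.sum_filter_add_sum_filter_not _ _ _).symm

/-- The channel gains for which all quantities entering the SINR of link `m` deviate from their
typical values by at most `y` (on the appropriate scales). -/
structure Typical (h : Fin K → Fin M → ℂ) (f : Fin M → Fin K → ℂ) (m : Fin M) (y : ℝ) : Prop where
  second_hop : ∑ k, ‖f m k‖ ^ 2 < K + √(K : ℝ) * y
  direct : (N.relays m).card * (Real.pi / 4) - √((N.relays m).card : ℝ) * y <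
    ∑ k ∈ N.relays m, ‖f m k‖ * ‖h k m‖
  direct_unassigned :
    ‖N.gainUnassigned h f m m‖ ^ 2 < c.CUp ^ 2 * (K + √(K : ℝ) * y) * (1 + y)
  cross_unassigned : ∑ m' ∈ Finset.univ.erase m, ‖N.gainUnassigned h f m m'‖ ^ 2 <
    c.CUp ^ 2 * (K + √(K : ℝ) * y) * ((M - 1 : ℝ) + √(M : ℝ) * y)
  cross_assigned : ∀ m' ≠ m, ‖N.gainAssigned h f m m'‖ ^ 2 <
    c.CUp ^ 2 * ((N.relays m').card + √((N.relays m').card : ℝ) * y) * (1 + y)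

end RelayNetwork

section
variable {c : RelayConstants} {K M : ℕ} (N : RelayNetwork c K M)

/-- The index set of all channel gains of the two hops. -/
abbrev ChannelIndex (K M : ℕ) := (Fin K × Fin M) ⊕ (Fin M × Fin K)

/-- The first-hop gains in a family of channel gains. -/
def firstHop (x : ChannelIndex K M → ℂ) (k : Fin K) (m : Fin M) : ℂ := x (Sum.inl (k, m))

/-- The second-hop gains in a family of channel gains. -/
def secondHop (x : ChannelIndex K M → ℂ) (m : Fin M) (k : Fin K) : ℂ := x (Sum.inr (m, k))

lemma measure_sum_norm_sq_coord_ge_le {ι : Type*} [Fintype ι] (J : Finset ι) {n : ℝ}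
    (hn : 1 ≤ n) (hJ : (J.card : ℝ) ≤ n) (y : ℝ) :
    gaussianFamily ι {x | J.card + √n * y ≤ ∑ j ∈ J, ‖x j‖ ^ 2}
      ≤ ENNReal.ofReal (Real.exp (1 / 4 - y / 2)) := by
  classical
  -- Singleton groups with unit coefficients; nothing is frozen.
  have h := measure_sum_norm_sq_ge_le (ι := ι) Finset.univ J id (fun _ _ => 1)
    (fun _ => measurable_const) (by simp) (fun _ _ => rfl)
    (fun _ j _ => by simp [Finset.filter_eq' Finset.univ j]) hn hJ y
  simpa [fun j : ι => Finset.filter_eq' Finset.univ j] using h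

lemma sum_channelIndex_filter_snd {E : Type*} [AddCommMonoid E] (w : ChannelIndex K M → E)
    (m j : Fin M) (hw : ∀ q, w (Sum.inr q) = 0) :
    ∑ i with Sum.elim (fun q : Fin K × Fin M => q.2) (fun _ : Fin M × Fin K => m) i = j, w i
      = ∑ k, w (Sum.inl (k, j)) := by
  rw [Finset.sum_filter, Fintype.sum_sum_type, Fintype.sum_prod_type]
  simp only [hw, Sum.elim_inl, Sum.elim_inr, ite_self, Finset.sum_const_zero, add_zero]
  exact Finset.sum_congr rfl fun k _ =>
    (Fintype.sum_eq_single j fun _ hy => if_neg hy).trans (if_pos rfl)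

/-- Relays with `p k ≠ j` have phases independent of `h k j`. Given everything else, the gains for
different `j` are linear forms in disjoint groups of first-hop variables, each of variance at most
`CUp² ∑ ‖f m k‖²`. Taking all `j ∈ J` together gives fluctuations of order `√n`, where a union bound
would lose a factor. -/
lemma measure_gainUnassigned_ge_le (m : Fin M) (J : Finset (Fin M)) {n : ℝ} (hn : 1 ≤ n)
    (hJ : (J.card : ℝ) ≤ n) {q : ℝ} (hq : 0 < q) (y : ℝ) :
    gaussianFamily (ChannelIndex K M) {x | ∑ k, ‖secondHop x m k‖ ^ 2 < q ∧
      c.CUp ^ 2 * q * (J.card + √n * y)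
        ≤ ∑ j ∈ J, ‖N.gainUnassigned (firstHop x) (secondHop x) m j‖ ^ 2}
      ≤ ENNReal.ofReal (Real.exp (1 / 4 - y / 2)) := by
  classical
  have hC := c.CUp_pos
  have hsq : √q ^ 2 = q := Real.sq_sqrt hq.le
  have hsq0 : 0 < √q := Real.sqrt_pos.2 hq
  let F : (ChannelIndex K M → ℂ) → Fin K → Fin M → ℂ := fun x k j =>
    (N.coefC m j k : ℂ) * star (phaseFactor (secondHop x (N.p k) k)) * secondHop x m k *
      star (phaseFactor (firstHop x k (N.p k)))
  -- Dividing by `CUp √q` and truncating to zero where the second-hop energy reaches `q` keeps the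
  -- group variances at most one everywhere; on the event in question the truncation is inactive.
  let C : (ChannelIndex K M → ℂ) → ChannelIndex K M → ℂ := fun x => Sum.elim
    (fun r => if N.p r.1 ≠ r.2 then
      (if ∑ k, ‖secondHop x m k‖ ^ 2 < q then F x r.1 r.2 / ((c.CUp * √q : ℝ) : ℂ) else 0) else 0)
    (fun _ => 0)
  have hF : ∀ x k j, ‖F x k j‖ ^ 2 ≤ c.CUp ^ 2 * ‖secondHop x m k‖ ^ 2 := by
    intro x k j
    simp only [F, norm_mul, norm_star, norm_phaseFactor, mul_one, Complex.norm_real,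
      Real.norm_eq_abs, mul_pow, sq_abs]
    have h1 := N.coefC_nonneg m j k
    have h2 := N.coefC_le_CUp m j k
    gcongr
  have hFm : ∀ k j, Measurable fun x => F x k j := by
    intro k j
    simp only [F, secondHop, firstHop]
    fun_prop
  have hCm : ∀ i, Measurable fun x => C x i := by
    rintro (⟨k, j⟩ | i)
    · simp only [C, Sum.elim_inl]
      by_cases hk : N.p k ≠ j
      · simp only [if_pos hk]
        refine Measurable.ite (measurableSet_lt ?_ measurable_const) ((hFm k j).div_const _)
          measurable_const
        simp only [secondHop]; fun_prop
      · simp only [if_neg hk]; exact measurable_const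
    · exact measurable_const
  have h := measure_sum_norm_sq_ge_le
    ((Finset.univ.filter fun r : Fin K × Fin M => N.p r.1 ≠ r.2).disjSum ∅) J
    (Sum.elim (fun r : Fin K × Fin M => r.2) (fun _ : Fin M × Fin K => m)) C hCm ?_ ?_ ?_ hn hJ y
  · refine (measure_mono ?_).trans h
    rintro x ⟨hx, hx'⟩
    have e : ∀ j, ‖N.gainUnassigned (firstHop x) (secondHop x) m j‖ ^ 2 = c.CUp ^ 2 * q *
        ‖∑ i with Sum.elim (fun r : Fin K × Fin M => r.2) (fun _ : Fin M × Fin K => m) i = j,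
          C x i * x i‖ ^ 2 := by
      intro j
      rw [sum_channelIndex_filter_snd _ _ _ (fun _ => by simp [C])]
      have : N.gainUnassigned (firstHop x) (secondHop x) m j
          = ((c.CUp * √q : ℝ) : ℂ) * ∑ k, C x (Sum.inl (k, j)) * x (Sum.inl (k, j)) := by
        have hne : ((c.CUp * √q : ℝ) : ℂ) ≠ 0 := by exact_mod_cast (by positivity)
        rw [RelayNetwork.gainUnassigned, Finset.sum_filter, Finset.mul_sum]
        refine Finset.sum_congr rfl fun k _ => ?_
        simp only [C, Sum.elim_inl, if_pos hx]
        split_ifs with hk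
        · rw [← mul_assoc, mul_div_cancel₀ _ hne]
          rfl
        · simp
      rw [this, norm_mul, mul_pow, Complex.norm_real, Real.norm_eq_abs, sq_abs, mul_pow, hsq]
    simp only [e, ← Finset.mul_sum] at hx'
    exact le_of_mul_le_mul_left hx' (by positivity)
  · rintro x (⟨k, j⟩ | i) hi
    · have : N.p k = j := by simpa using hi
      simp [C, this]
    · rfl
  · intro a b
    have h1 : ∀ k j, secondHop (Finset.piecewise ((Finset.univ.filter
        fun r : Fin K × Fin M => N.p r.1 ≠ r.2).disjSum ∅) a b) j k = secondHop b j k := by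
      intro k j; simp [secondHop, Finset.piecewise]
    have h2 : ∀ k, firstHop (Finset.piecewise ((Finset.univ.filter
        fun r : Fin K × Fin M => N.p r.1 ≠ r.2).disjSum ∅) a b) k (N.p k)
        = firstHop b k (N.p k) := by
      intro k; simp [firstHop, Finset.piecewise]
    simp only [C, F, h1, h2]
  · intro x j _
    rw [sum_channelIndex_filter_snd _ _ _ (fun _ => by simp [C])]
    by_cases hx : ∑ k, ‖secondHop x m k‖ ^ 2 < q
    · calc ∑ k, ‖C x (Sum.inl (k, j))‖ ^ 2 ≤ ∑ k, ‖secondHop x m k‖ ^ 2 / q := by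
            refine Finset.sum_le_sum fun k _ => ?_
            simp only [C, Sum.elim_inl, if_pos hx]
            split_ifs with hk
            · rw [norm_div, div_pow, Complex.norm_real, Real.norm_eq_abs, sq_abs, mul_pow, hsq,
                div_le_div_iff₀ (by positivity) hq]
              nlinarith [hF x k j]
            · simp; positivity
        _ ≤ 1 := by
            rw [← Finset.sum_div, div_le_one hq]; exact hx.le
    · simp [C, hx]

/-- For a relay assigned to `m' ≠ m` the phases involve `f m' k` and `h k m'` only, so the roles of
the hops are exchanged: the gain is linear in the variables `f m k`, with conditional variance at
most `CUp² ∑ ‖h k m'‖²`. -/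
lemma measure_gainAssigned_ge_le {m m' : Fin M} (hm : m' ≠ m) {q : ℝ} (hq : 0 < q) (y : ℝ) :
    gaussianFamily (ChannelIndex K M) {x | ∑ k ∈ N.relays m', ‖firstHop x k m'‖ ^ 2 < q ∧
      c.CUp ^ 2 * q * (1 + y)
        ≤ ‖N.gainAssigned (firstHop x) (secondHop x) m m'‖ ^ 2}
      ≤ ENNReal.ofReal (Real.exp (1 / 4 - y / 2)) := by
  classical
  have hC := c.CUp_pos
  have hsq : √q ^ 2 = q := Real.sq_sqrt hq.le
  have hsq0 : 0 < √q := Real.sqrt_pos.2 hq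
  let F : (ChannelIndex K M → ℂ) → Fin K → ℂ := fun x k =>
    (N.coefC m m' k : ℂ) * star (phaseFactor (secondHop x (N.p k) k)) *
      star (phaseFactor (firstHop x k (N.p k))) * firstHop x k m'
  let C : (ChannelIndex K M → ℂ) → ChannelIndex K M → ℂ := fun x => Sum.elim (fun _ => 0)
    (fun r => if r.1 = m then if r.2 ∈ N.relays m' then
      (if ∑ k ∈ N.relays m', ‖firstHop x k m'‖ ^ 2 < q
        then F x r.2 / ((c.CUp * √q : ℝ) : ℂ) else 0) else 0 else 0)
  have hF : ∀ x k, ‖F x k‖ ^ 2 ≤ c.CUp ^ 2 * ‖firstHop x k m'‖ ^ 2 := by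
    intro x k
    simp only [F, norm_mul, norm_star, norm_phaseFactor, mul_one, Complex.norm_real,
      Real.norm_eq_abs, mul_pow, sq_abs]
    have h1 := N.coefC_nonneg m m' k
    have h2 := N.coefC_le_CUp m m' k
    gcongr
  have hFm : ∀ k, Measurable fun x => F x k := by
    intro k
    simp only [F, secondHop, firstHop]
    fun_prop
  have hCm : ∀ i, Measurable fun x => C x i := by
    rintro (i | ⟨j, k⟩)
    · exact measurable_const
    · simp only [C, Sum.elim_inr]
      by_cases hj : j = m
      · by_cases hk : k ∈ N.relays m'
        · simp only [if_pos hk, if_pos hj]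
          refine Measurable.ite (measurableSet_lt ?_ measurable_const) ((hFm k).div_const _)
            measurable_const
          simp only [firstHop]; fun_prop
        · simp only [if_neg hk, ite_self]; exact measurable_const
      · simp only [if_neg hj]; exact measurable_const
  have hsum : ∀ {E : Type} [AddCommMonoid E] (w : ChannelIndex K M → E),
      (∀ i, w (Sum.inl i) = 0) → (∀ j k, j ≠ m → w (Sum.inr (j, k)) = 0) →
      (∀ k ∉ N.relays m', w (Sum.inr (m, k)) = 0) →
      ∑ i, w i = ∑ k ∈ N.relays m', w (Sum.inr (m, k)) := by
    intro E _ w h1 h2 h3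
    rw [Fintype.sum_sum_type, Fintype.sum_prod_type (f := fun r => w (Sum.inr r)),
      Finset.sum_eq_zero fun i _ => h1 i, zero_add, Fintype.sum_eq_single m
      fun j hj => Finset.sum_eq_zero fun k _ => h2 j k hj]
    exact (Finset.sum_subset (Finset.subset_univ _) fun k _ hk => h3 k hk).symm
  have h := measure_sum_norm_sq_ge_le
    ((∅ : Finset (Fin K × Fin M)).disjSum
      (Finset.univ.filter fun r : Fin M × Fin K => r.1 = m ∧ r.2 ∈ N.relays m')) {()}
    (fun _ => ()) C hCm ?_ ?_ ?_ le_rfl (by simp) y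
  · refine (measure_mono ?_).trans h
    rintro x ⟨hx, hx'⟩
    have e : ‖N.gainAssigned (firstHop x) (secondHop x) m m'‖ ^ 2 = c.CUp ^ 2 * q *
        ‖∑ i, C x i * x i‖ ^ 2 := by
      rw [hsum _ (fun i => by simp [C]) (fun j k hj => by simp [C, hj])
        (fun k hk => by simp [C, hk])]
      have : N.gainAssigned (firstHop x) (secondHop x) m m' = ((c.CUp * √q : ℝ) : ℂ) *
          ∑ k ∈ N.relays m', C x (Sum.inr (m, k)) * x (Sum.inr (m, k)) := by
        have hne : ((c.CUp * √q : ℝ) : ℂ) ≠ 0 := by exact_mod_cast (by positivity)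
        rw [RelayNetwork.gainAssigned, Finset.mul_sum]
        refine Finset.sum_congr rfl fun k hk => ?_
        simp only [C, Sum.elim_inr, if_pos hx, if_pos hk, if_true]
        rw [← mul_assoc, mul_div_cancel₀ _ hne]
        simp only [F, RelayNetwork.a, secondHop]
        ring
      rw [this, norm_mul, mul_pow, Complex.norm_real, Real.norm_eq_abs, sq_abs, mul_pow, hsq]
    rw [e] at hx'
    have := le_of_mul_le_mul_left hx' (by positivity)
    simpa using this
  · rintro x (i | ⟨j, k⟩) hi
    · rfl
    · by_cases hj : j = m
      · have : k ∉ N.relays m' := by simpa [hj] using hi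
        simp [C, this]
      · simp [C, hj]
  · intro a b
    have h1 : ∀ k j, firstHop (Finset.piecewise ((∅ : Finset (Fin K × Fin M)).disjSum
        (Finset.univ.filter fun r : Fin M × Fin K => r.1 = m ∧ r.2 ∈ N.relays m')) a b) k j
        = firstHop b k j := by
      intro k j; simp [firstHop, Finset.piecewise]
    -- This uses `m' ≠ m`: resampling the gains `f m k` leaves the phases of `f m' k` unchanged.
    have h2 : ∀ k ∈ N.relays m', secondHop (Finset.piecewise
        ((∅ : Finset (Fin K × Fin M)).disjSum
        (Finset.univ.filter fun r : Fin M × Fin K => r.1 = m ∧ r.2 ∈ N.relays m')) a b) (N.p k) k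
        = secondHop b (N.p k) k := by
      intro k hk
      have : N.p k = m' := by simpa [RelayNetwork.relays] using hk
      simp [secondHop, Finset.piecewise, this, hm]
    ext (i | ⟨j, k⟩)
    · rfl
    · by_cases hk : k ∈ N.relays m'
      · simp only [C, F, h1, h2 k hk, Sum.elim_inr]
      · simp only [C, Sum.elim_inr, if_neg hk]
  · intro x j _
    simp only [Finset.filter_true]
    rw [hsum _ (fun i => by simp [C]) (fun j k hj => by simp [C, hj])
        (fun k hk => by simp [C, hk])]
    by_cases hx : ∑ k ∈ N.relays m', ‖firstHop x k m'‖ ^ 2 < q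
    · calc ∑ k ∈ N.relays m', ‖C x (Sum.inr (m, k))‖ ^ 2
          ≤ ∑ k ∈ N.relays m', ‖firstHop x k m'‖ ^ 2 / q := by
            refine Finset.sum_le_sum fun k hk => ?_
            simp only [C, Sum.elim_inr, if_pos hx, if_pos hk, if_true]
            rw [norm_div, div_pow, Complex.norm_real, Real.norm_eq_abs, sq_abs, mul_pow, hsq,
                div_le_div_iff₀ (by positivity) hq]
            nlinarith [hF x k]
        _ ≤ 1 := by
            rw [← Finset.sum_div, div_le_one hq]; exact hx.le
    · simp [C, hx]

end

/-! ### Probability of atypical channel gains. -/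

section
variable {c : RelayConstants} {K M : ℕ} (N : RelayNetwork c K M)

lemma measure_sum_secondHop_ge_le (hK : 0 < K) (m : Fin M) (y : ℝ) :
    gaussianFamily (ChannelIndex K M) {x | (K : ℝ) + √(K : ℝ) * y ≤ ∑ k, ‖secondHop x m k‖ ^ 2}
      ≤ ENNReal.ofReal (Real.exp (1 / 4 - y / 2)) := by
  have h := measure_sum_norm_sq_coord_ge_le (ι := ChannelIndex K M)
    (Finset.univ.map ⟨fun k : Fin K => Sum.inr (m, k), fun _ _ h => by simpa using h⟩)
    (n := K) (by exact_mod_cast hK) (by simp) y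
  simp only [Finset.sum_map, Finset.card_map, Finset.card_univ, Fintype.card_fin] at h
  exact h

lemma measure_sum_firstHop_ge_le (A : Finset (Fin K)) (hA : 0 < A.card) (m : Fin M) (y : ℝ) :
    gaussianFamily (ChannelIndex K M)
        {x | (A.card : ℝ) + √(A.card : ℝ) * y ≤ ∑ k ∈ A, ‖firstHop x k m‖ ^ 2}
      ≤ ENNReal.ofReal (Real.exp (1 / 4 - y / 2)) := by
  have h := measure_sum_norm_sq_coord_ge_le (ι := ChannelIndex K M)
    (A.map ⟨fun k : Fin K => Sum.inl (k, m), fun _ _ h => by simpa using h⟩)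
    (n := A.card) (by exact_mod_cast hA) (by simp) y
  simp only [Finset.sum_map, Finset.card_map] at h
  exact h

namespace RelayNetwork

lemma mul_card_relays (m : Fin M) : M * (N.relays m).card = K := N.card_assigned m

lemma card_relays_pos (hK : 0 < K) (m : Fin M) : 0 < (N.relays m).card := by
  rcases Nat.eq_zero_or_pos (N.relays m).card with h | h
  · have := N.mul_card_relays m
    rw [h] at this; omega
  · exact h

/-- Atypical channel gains have small probability. -/
lemma measure_not_typical_le (hK : 0 < K) (m : Fin M) {y : ℝ} (hy : 0 ≤ y) :
    gaussianFamily (ChannelIndex K M) {x | ¬ N.Typical (firstHop x) (secondHop x) m y}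
      ≤ ENNReal.ofReal ((2 * M + 2) * Real.exp (1 / 2 - y / 2)) := by
  set μ := gaussianFamily (ChannelIndex K M)
  set η := ENNReal.ofReal (Real.exp (1 / 2 - y / 2)) with hη
  have hM : 0 < M := N.numPairs_pos hK
  have hK' : (0 : ℝ) < K := by exact_mod_cast hK
  have mono : ENNReal.ofReal (Real.exp (1 / 4 - y / 2)) ≤ η :=
    ENNReal.ofReal_le_ofReal (Real.exp_le_exp.2 (by linarith))
  set q : ℝ := K + √(K : ℝ) * y
  have hq : 0 < q := by positivity
  let q' : Fin M → ℝ := fun m' => (N.relays m').card + √((N.relays m').card : ℝ) * y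
  have hq' : ∀ m', 0 < q' m' := fun m' => by
    have : (0 : ℝ) < (N.relays m').card := by exact_mod_cast N.card_relays_pos hK m'
    positivity
  let BQ : Set (ChannelIndex K M → ℂ) := {x | q ≤ ∑ k, ‖secondHop x m k‖ ^ 2}
  let BD : Set (ChannelIndex K M → ℂ) := {x | ∑ k ∈ N.relays m,
    ‖secondHop x m k‖ * ‖firstHop x k m‖ ≤
      (N.relays m).card * (Real.pi / 4) - √((N.relays m).card : ℝ) * y}
  let BU : Set (ChannelIndex K M → ℂ) := {x | ∑ k, ‖secondHop x m k‖ ^ 2 < q ∧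
      c.CUp ^ 2 * q * (({m} : Finset (Fin M)).card + √1 * y)
        ≤ ∑ j ∈ {m}, ‖N.gainUnassigned (firstHop x) (secondHop x) m j‖ ^ 2}
  let BC : Set (ChannelIndex K M → ℂ) := {x | ∑ k, ‖secondHop x m k‖ ^ 2 < q ∧
      c.CUp ^ 2 * q * ((Finset.univ.erase m).card + √(M : ℝ) * y)
        ≤ ∑ j ∈ Finset.univ.erase m, ‖N.gainUnassigned (firstHop x) (secondHop x) m j‖ ^ 2}
  let BH : Fin M → Set (ChannelIndex K M → ℂ) := fun m' =>
    {x | q' m' ≤ ∑ k ∈ N.relays m', ‖firstHop x k m'‖ ^ 2}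
  let BT : Fin M → Set (ChannelIndex K M → ℂ) := fun m' =>
    {x | ∑ k ∈ N.relays m', ‖firstHop x k m'‖ ^ 2 < q' m' ∧ c.CUp ^ 2 * q' m' * (1 + y)
        ≤ ‖N.gainAssigned (firstHop x) (secondHop x) m m'‖ ^ 2}
  have hcard : ((Finset.univ.erase m).card : ℝ) = M - 1 := by
    rw [Finset.card_erase_of_mem (Finset.mem_univ m), Finset.card_univ, Fintype.card_fin,
      Nat.cast_sub hM]
    simp
  have pQ : μ BQ ≤ η := (measure_sum_secondHop_ge_le hK m y).trans mono
  have pD : μ BD ≤ η := by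
    have hn : (1 : ℝ) ≤ (N.relays m).card := by exact_mod_cast N.card_relays_pos hK m
    refine (measure_sum_norm_mul_norm_le (ι := ChannelIndex K M) (N.relays m)
      (u := fun k => Sum.inr (m, k)) (v := fun k => Sum.inl (k, m))
      (fun _ _ h => by simpa using h) (fun _ _ h => by simpa using h)
      ((∅ : Finset (Fin K × Fin M)).disjSum Finset.univ) (by simp) (by simp) hn le_rfl y).trans ?_
    exact ENNReal.ofReal_le_ofReal (Real.exp_le_exp.2 (by linarith))
  have pU : μ BU ≤ η :=
    (measure_gainUnassigned_ge_le N m {m} le_rfl (by simp) hq y).trans mono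
  have pC : μ BC ≤ η :=
    (measure_gainUnassigned_ge_le N m (Finset.univ.erase m) (n := M) (by exact_mod_cast hM)
      (by rw [hcard]; linarith) hq y).trans mono
  have pH : ∀ m', μ (BH m') ≤ η := fun m' =>
    (measure_sum_firstHop_ge_le (N.relays m') (N.card_relays_pos hK m') m' y).trans mono
  have pT : ∀ m' ∈ Finset.univ.erase m, μ (BT m') ≤ η := fun m' hm' =>
    (measure_gainAssigned_ge_le N (Finset.ne_of_mem_erase hm') (hq' m') y).trans mono
  -- Four events, plus two for each `m' ≠ m`: `4 + 2(M - 1) = 2M + 2` in all.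
  have hsub : {x | ¬ N.Typical (firstHop x) (secondHop x) m y} ⊆
      ((BQ ∪ BD) ∪ (BU ∪ BC)) ∪ ⋃ m' ∈ Finset.univ.erase m, (BH m' ∪ BT m') := by
    intro x hx
    by_contra hc
    simp only [Set.mem_union, Set.mem_iUnion, not_or, not_exists] at hc
    obtain ⟨⟨⟨h1, h2⟩, h3, h4⟩, h5⟩ := hc
    have h1' : ∑ k, ‖secondHop x m k‖ ^ 2 < q := not_le.1 h1
    refine hx ⟨h1', not_le.1 h2, ?_, ?_, fun m' hm' => ?_⟩
    · have : ¬ (_ ≤ _) := fun h => h3 ⟨h1', h⟩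
      simpa using this
    · have : ¬ (_ ≤ _) := fun h => h4 ⟨h1', h⟩
      rw [hcard] at this
      exact not_le.1 this
    · obtain ⟨h6, h7⟩ := h5 m' (Finset.mem_erase.2 ⟨hm', Finset.mem_univ _⟩)
      exact not_le.1 fun h => h7 ⟨not_le.1 h6, h⟩
  calc μ {x | ¬ N.Typical (firstHop x) (secondHop x) m y}
      ≤ μ (((BQ ∪ BD) ∪ (BU ∪ BC)) ∪ ⋃ m' ∈ Finset.univ.erase m, (BH m' ∪ BT m')) :=
        measure_mono hsub
    _ ≤ ((η + η) + (η + η)) + ∑ m' ∈ Finset.univ.erase m, (η + η) := by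
        refine (measure_union_le _ _).trans (add_le_add ?_ ?_)
        · refine (measure_union_le _ _).trans (add_le_add ?_ ?_)
          · exact (measure_union_le _ _).trans (add_le_add pQ pD)
          · exact (measure_union_le _ _).trans (add_le_add pU pC)
        · refine (measure_biUnion_finset_le _ _).trans (Finset.sum_le_sum fun m' hm' => ?_)
          exact (measure_union_le _ _).trans (add_le_add (pH m') (pT m' hm'))
    _ = ENNReal.ofReal ((2 * M + 2) * Real.exp (1 / 2 - y / 2)) := by
        have he := (Real.exp_pos (1 / 2 - y / 2)).le
        rw [Finset.sum_const, nsmul_eq_mul, ← ENNReal.ofReal_natCast, hcard, hη]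
        have hM1 : (0 : ℝ) ≤ M - 1 := by
          rw [sub_nonneg]; exact_mod_cast hM
        rw [← ENNReal.ofReal_add he he, ← ENNReal.ofReal_mul hM1,
          ← ENNReal.ofReal_add (by positivity) (by positivity),
          ← ENNReal.ofReal_add (by positivity) (by positivity)]
        congr 1; ring

/-- The outage probability is bounded by the probability of atypical channel gains. -/
lemma outageProb_le (hK : 0 < K) (m : Fin M) {R y : ℝ} (hy : 0 ≤ y)
    (H : ∀ h f, N.Typical h f m y → R < 1 / 2 * Real.logb 2 (1 + N.SINR h f m))
    {Ω : Type*} [MeasurableSpace Ω] (μ : Measure Ω) [IsProbabilityMeasure μ]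
    (h : Fin K → Fin M → Ω → ℂ) (f : Fin M → Fin K → Ω → ℂ) (hc : IsRayleighChannel μ h f) :
    N.outageProb μ h f m R ≤ (2 * M + 2) * Real.exp (1 / 2 - y / 2) := by
  let X : ChannelIndex K M → Ω → ℂ :=
    Sum.elim (fun q : Fin K × Fin M => h q.1 q.2) (fun q : Fin M × Fin K => f q.1 q.2)
  have hlaw : ∀ i, HasLaw (X i) (circGaussian 1) μ := by
    rintro (q | q)
    · exact hc.law_h q.1 q.2
    · exact hc.law_f q.1 q.2
  have hm : ∀ i, AEMeasurable (X i) μ := fun i => (hlaw i).aemeasurable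
  have hmap : μ.map (fun ω i => X i ω) = gaussianFamily (ChannelIndex K M) := by
    rw [(iIndepFun_iff_map_fun_eq_pi_map hm).1 hc.indep]
    congr 1
    ext1 i
    exact (hlaw i).map_eq
  refine ENNReal.toReal_le_of_le_ofReal (by positivity) ?_
  refine le_trans ?_ (N.measure_not_typical_le hK m hy)
  rw [← hmap]
  -- This direction of the image-measure inequality holds for every set, so measurability of the
  -- typical event is not needed.
  refine le_trans (measure_mono ?_) (Measure.le_map_apply (aemeasurable_pi_lambda _ hm) _)
  intro ω hω ht
  exact absurd hω (not_le.2 (H _ _ ht))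

end RelayNetwork
end

/-! ### Deterministic SINR estimate on the typical event. -/

/-- The weight `t` will be `√M`: the dominant unassigned interference is then inflated only by `1 +
1/√M`, while the assigned part, smaller by a factor of order `M`, can afford `1 + √M`. -/
lemma norm_add_sq_le_of_pos (z w : ℂ) {t : ℝ} (ht : 0 < t) :
    ‖z + w‖ ^ 2 ≤ (1 + t) * ‖z‖ ^ 2 + (1 + 1 / t) * ‖w‖ ^ 2 := by
  have h1 : ‖z + w‖ ^ 2 ≤ (‖z‖ + ‖w‖) ^ 2 := by
    have := norm_add_le z w
    gcongr
  have h2 : 2 * (‖z‖ * ‖w‖) ≤ t * ‖z‖ ^ 2 + 1 / t * ‖w‖ ^ 2 := by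
    have h3 : 0 ≤ 1 / t * (t * ‖z‖ - ‖w‖) ^ 2 := by positivity
    have h4 : 1 / t * (t * ‖z‖ - ‖w‖) ^ 2
        = t * ‖z‖ ^ 2 + 1 / t * ‖w‖ ^ 2 - 2 * (‖z‖ * ‖w‖) := by field_simp; ring
    linarith
  nlinarith

namespace RelayNetwork
variable {c : RelayConstants} {K M : ℕ} (N : RelayNetwork c K M)

/-- Both phase factors cancel, so the sum has nonnegative real terms and no cancellation occurs. -/
lemma norm_gainAssigned_self (h : Fin K → Fin M → ℂ) (f : Fin M → Fin K → ℂ) (m : Fin M) :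
    c.CLow * ∑ k ∈ N.relays m, ‖f m k‖ * ‖h k m‖ ≤ ‖N.gainAssigned h f m m‖ := by
  have e : N.gainAssigned h f m m
      = ((∑ k ∈ N.relays m, N.coefC m m k * (‖f m k‖ * ‖h k m‖) : ℝ) : ℂ) := by
    rw [gainAssigned, Complex.ofReal_sum]
    refine Finset.sum_congr rfl fun k hk => ?_
    have hp : N.p k = m := by simpa [relays] using hk
    rw [a, hp]
    calc _ = (N.coefC m m k : ℂ) * (star (phaseFactor (f m k)) * f m k) *
          (star (phaseFactor (h k m)) * h k m) := by ring
      _ = _ := by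
        rw [star_phaseFactor_mul_self, star_phaseFactor_mul_self]; push_cast; ring
  rw [e, Complex.norm_real, Real.norm_eq_abs, Finset.mul_sum]
  refine le_trans (Finset.sum_le_sum fun k _ => ?_) (le_abs_self _)
  exact mul_le_mul_of_nonneg_right (N.CLow_le_coefC m m k) (by positivity)

lemma sum_norm_b_sq_le (h : Fin K → Fin M → ℂ) (f : Fin M → Fin K → ℂ) (m : Fin M) :
    ∑ k, ‖N.b h f m k‖ ^ 2 ≤ c.cUp ^ 2 * ∑ k, ‖f m k‖ ^ 2 := by
  rw [Finset.mul_sum]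
  refine Finset.sum_le_sum fun k _ => ?_
  simp only [b, norm_mul, norm_star, norm_phaseFactor, mul_one, Complex.norm_real,
    Real.norm_eq_abs, mul_pow, sq_abs]
  have h1 := N.coefc_nonneg m k
  have h2 := N.coefc_le_cUp m k
  gcongr

variable {N} in
lemma Typical.interference_le {h : Fin K → Fin M → ℂ} {f : Fin M → Fin K → ℂ} {m : Fin M} {y : ℝ}
    (T : N.Typical h f m y) (hK : 0 < K) (hy : 0 ≤ y) :
    ∑ m' ∈ Finset.univ.erase m, ‖∑ k, N.a h f m m' k‖ ^ 2
      ≤ K * M * c.CUp ^ 2 + K * √(M : ℝ) * (5 * (c.CUp ^ 2 * (1 + y) ^ 2)) := by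
  have hMn := N.numPairs_pos hK
  have hM : (1 : ℝ) ≤ M := by exact_mod_cast hMn
  have hK' : (0 : ℝ) < K := by exact_mod_cast hK
  set B := c.CUp ^ 2 with hB
  have hB0 : 0 ≤ B := by positivity
  set r := √(M : ℝ) with hr
  have hr1 : 1 ≤ r := Real.one_le_sqrt.2 hM
  have hrr : r * r = M := Real.mul_self_sqrt (by positivity)
  set s := √(K : ℝ) with hs
  have hss : s * s = K := Real.mul_self_sqrt (by positivity)
  have hMK : (M : ℝ) ≤ K := by
    exact_mod_cast Nat.le_of_dvd hK ⟨_, (N.mul_card_relays m).symm⟩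
  have hrs : r ≤ s := Real.sqrt_le_sqrt hMK
  have hτ : B ≤ B * (1 + y) ^ 2 := le_mul_of_one_le_right hB0 (by nlinarith)
  set τ := B * (1 + y) ^ 2 with hτd
  have hτ0 : 0 ≤ τ := hB0.trans hτ
  have U : ∑ m' ∈ Finset.univ.erase m, ‖N.gainUnassigned h f m m'‖ ^ 2
      ≤ K * M * B + K * r * τ := by
    refine T.cross_unassigned.le.trans ?_
    have e1 : B * (K + s * y) * (M - 1 + r * y)
        = B * K * M - B * K - B * s * y + B * (K * r * y + s * r * r * y + s * r * y ^ 2) := by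
      rw [← hrr]; ring
    rw [e1]
    have h1 : s * r * r * y ≤ K * r * y := by
      rw [← hss]
      have : s * r * r * y ≤ s * s * r * y := by gcongr
      exact this
    have h2 : s * r * y ^ 2 ≤ K * r * y ^ 2 := by
      rw [← hss]
      have h1s : s ≤ s * s := le_mul_of_one_le_left (by positivity) (hr1.trans hrs)
      gcongr
    have h3 : B * (K * r * y + s * r * r * y + s * r * y ^ 2)
        ≤ B * (K * r * y + K * r * y + K * r * y ^ 2) := by gcongr
    have h4 : K * r * τ = B * (K * r * y + K * r * y + K * r * y ^ 2) + B * K * r := by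
      rw [hτd]; ring
    have h5 : 0 ≤ B * K * r := by positivity
    have h6 : 0 ≤ B * s * y := by positivity
    have h7 : 0 ≤ B * K := by positivity
    nlinarith
  have V : ∑ m' ∈ Finset.univ.erase m, ‖N.gainAssigned h f m m'‖ ^ 2 ≤ K * τ := by
    calc _ ≤ ∑ m' ∈ Finset.univ.erase m, ((N.relays m').card : ℝ) * τ := by
          refine Finset.sum_le_sum fun m' hm' => ?_
          refine (T.cross_assigned m' (Finset.ne_of_mem_erase hm')).le.trans ?_
          have hn : (1 : ℝ) ≤ (N.relays m').card := by exact_mod_cast N.card_relays_pos hK m'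
          have hsn : √((N.relays m').card : ℝ) ≤ (N.relays m').card :=
            Real.sqrt_le_iff.2 ⟨by positivity, by nlinarith⟩
          calc _ ≤ B * ((N.relays m').card + ((N.relays m').card : ℝ) * y) * (1 + y) := by gcongr
            _ = _ := by rw [hτd]; ring
      _ ≤ ∑ m' : Fin M, ((N.relays m').card : ℝ) * τ :=
          Finset.sum_le_sum_of_subset_of_nonneg (Finset.subset_univ _)
            fun _ _ _ => by positivity
      _ = K * τ := by
          have : ∀ m', ((N.relays m').card : ℝ) = K / M := fun m' => by
            rw [eq_div_iff (by positivity)]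
            have := N.mul_card_relays m'
            rw [mul_comm]; exact_mod_cast this
          simp only [this, Finset.sum_const, Finset.card_univ, Fintype.card_fin, nsmul_eq_mul]
          field_simp
  have hr0 : 0 < r := by linarith
  calc _ ≤ ∑ m' ∈ Finset.univ.erase m, ((1 + r) * ‖N.gainAssigned h f m m'‖ ^ 2
        + (1 + 1 / r) * ‖N.gainUnassigned h f m m'‖ ^ 2) := by
        refine Finset.sum_le_sum fun m' _ => ?_
        rw [N.sum_a_eq]
        exact norm_add_sq_le_of_pos _ _ hr0
    _ ≤ (1 + r) * (K * τ) + (1 + 1 / r) * (K * M * B + K * r * τ) := by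
        rw [Finset.sum_add_distrib, ← Finset.mul_sum, ← Finset.mul_sum]
        gcongr
    _ = K * M * B + (K * τ + 2 * (K * r * τ) + K * r * B + K * τ) := by
        rw [← hrr]; field_simp; ring
    _ ≤ _ := by
        -- Two terms `K τ`, one `K r B` and twice `K r τ` are each at most `K r τ`, whence the
        -- constant `5`.
        have h1 : K * τ ≤ K * r * τ := by nlinarith [mul_nonneg hK'.le hτ0]
        have h2 : K * r * B ≤ K * r * τ := by gcongr
        linarith

variable {N} in
lemma Typical.lt_SINR {h : Fin K → Fin M → ℂ} {f : Fin M → Fin K → ℂ} {m : Fin M} {x y s : ℝ}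
    (T : N.Typical h f m y) (hK : 0 < K) (hy : 0 ≤ y) (hx : 1 ≤ x) (hs : 0 ≤ s)
    (h1 : c.CLow * y ≤ x) (h2 : c.cUp ^ 2 * y ≤ x) (h3 : 5 * (c.CUp ^ 2 * (1 + y) ^ 2) ≤ 3 * x)
    (h4 : 2 * √(K : ℝ) * x < Real.pi * c.CLow * K / (4 * M))
    (h5 : s * (K * M * (c.CSN ^ 2 + 3 * x / √(M : ℝ) + c.σ ^ 2 * x / √(K : ℝ)))
      ≤ (Real.pi * c.CLow * K / (4 * M) - 2 * √(K : ℝ) * x) ^ 2) :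
    s < N.SINR h f m := by
  have hMn := N.numPairs_pos hK
  have hM : (1 : ℝ) ≤ M := by exact_mod_cast hMn
  have hK' : (0 : ℝ) < K := by exact_mod_cast hK
  have hσ := c.σ_pos
  have hCL := c.CLow_pos
  set r := √(M : ℝ) with hr
  have hr1 : 1 ≤ r := Real.one_le_sqrt.2 hM
  have hrr : r * r = M := Real.mul_self_sqrt (by positivity)
  set t := √(K : ℝ) with ht
  have htt : t * t = K := Real.mul_self_sqrt (by positivity)
  have ht1 : 1 ≤ t := Real.one_le_sqrt.2 (by exact_mod_cast hK)
  have hn : ((N.relays m).card : ℝ) = K / M := by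
    rw [eq_div_iff (by positivity)]
    have := N.mul_card_relays m
    rw [mul_comm]; exact_mod_cast this
  -- One `√K x` pays for the fluctuation of the coherent sum, the other for the unassigned relays.
  have num : Real.pi * c.CLow * K / (4 * M) - 2 * t * x < ‖∑ k, N.a h f m m k‖ := by
    have hD := T.direct
    have hU : ‖N.gainUnassigned h f m m‖ ≤ t * x := by
      refine le_of_sq_le_sq ?_ (by positivity)
      refine T.direct_unassigned.le.trans ?_
      have h6 : (K : ℝ) + t * y ≤ K * (1 + y) := by
        rw [← htt]
        nlinarith [mul_nonneg (mul_nonneg (by positivity : 0 ≤ t) (sub_nonneg.2 ht1)) hy]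
      calc _ ≤ c.CUp ^ 2 * (K * (1 + y)) * (1 + y) := by gcongr
        _ = K * (c.CUp ^ 2 * (1 + y) ^ 2) := by ring
        _ ≤ K * x ^ 2 := by
          have : 0 ≤ c.CUp ^ 2 * (1 + y) ^ 2 := by positivity
          -- By `h3` the left side is at most `3x/5`, hence at most `x²` as `x ≥ 1`.
          gcongr; nlinarith
        _ = _ := by rw [← htt]; ring
    have hA : Real.pi * c.CLow * K / (4 * M) - t * x < ‖N.gainAssigned h f m m‖ := by
      refine lt_of_lt_of_le ?_ (N.norm_gainAssigned_self h f m)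
      refine lt_of_le_of_lt ?_ (mul_lt_mul_of_pos_left hD hCL)
      have h7 : √((N.relays m).card : ℝ) ≤ t := Real.sqrt_le_sqrt (by
        rw [hn]; exact div_le_self hK'.le hM)
      have h8 : c.CLow * (√((N.relays m).card : ℝ) * y) ≤ t * x := by
        calc _ = √((N.relays m).card : ℝ) * (c.CLow * y) := by ring
          _ ≤ t * x := by gcongr
      have h9 : c.CLow * ((N.relays m).card * (Real.pi / 4)) = Real.pi * c.CLow * K / (4 * M) := by
        rw [hn]; field_simp
      rw [mul_sub, h9]; linarith
    have := norm_sub_le_norm_add (N.gainAssigned h f m m) (N.gainUnassigned h f m m)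
    rw [N.sum_a_eq]
    linarith
  have den : ∑ m' ∈ Finset.univ.erase m, ‖∑ k, N.a h f m m' k‖ ^ 2 +
      c.σ ^ 2 * M * ∑ k, ‖N.b h f m k‖ ^ 2 + K * M * c.σ ^ 2
      ≤ K * M * (c.CSN ^ 2 + 3 * x / r + c.σ ^ 2 * x / t) := by
    have hI := T.interference_le hK hy
    have hb : ∑ k, ‖N.b h f m k‖ ^ 2 ≤ c.cUp ^ 2 * K + t * x := by
      refine (N.sum_norm_b_sq_le h f m).trans ?_
      calc _ ≤ c.cUp ^ 2 * (K + t * y) := by gcongr; exact T.second_hop.le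
        _ = c.cUp ^ 2 * K + t * (c.cUp ^ 2 * y) := by ring
        _ ≤ _ := by gcongr
    calc _ ≤ (K * M * c.CUp ^ 2 + K * r * (3 * x)) + c.σ ^ 2 * M * (c.cUp ^ 2 * K + t * x)
          + K * M * c.σ ^ 2 := by
          have : K * r * (5 * (c.CUp ^ 2 * (1 + y) ^ 2)) ≤ K * r * (3 * x) := by gcongr
          gcongr
          linarith
      _ = _ := by
        rw [c.CSN_sq, ← hrr, ← htt]
        have hr0 : r ≠ 0 := by positivity
        have ht0 : t ≠ 0 := by positivity
        field_simp
        ring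
  have den_pos : 0 < ∑ m' ∈ Finset.univ.erase m, ‖∑ k, N.a h f m m' k‖ ^ 2 +
      c.σ ^ 2 * M * ∑ k, ‖N.b h f m k‖ ^ 2 + K * M * c.σ ^ 2 := by
    refine add_pos_of_nonneg_of_pos (add_nonneg (Finset.sum_nonneg fun _ _ => sq_nonneg _)
      (mul_nonneg (by positivity) (Finset.sum_nonneg fun _ _ => sq_nonneg _))) (by positivity)
  rw [SINR, lt_div_iff₀ den_pos]
  calc _ ≤ s * (K * M * (c.CSN ^ 2 + 3 * x / r + c.σ ^ 2 * x / t)) := by gcongr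
    _ ≤ _ := h5
    _ < _ := by
      have : 0 < Real.pi * c.CLow * K / (4 * M) - 2 * t * x := by linarith
      gcongr

end RelayNetwork

/-! ### The scale `L = Δ x^(2/7)` and the role of `x(R)`. -/

namespace RelayConstants
variable (c : RelayConstants)

lemma ΔP1_pos : 0 < c.ΔP1 := by
  have := c.CUp_pos; have := c.cUp_pos
  unfold ΔP1
  refine lt_min (lt_min ?_ ?_) (lt_min ?_ ?_) <;> positivity

lemma ΔP1_le_one : c.ΔP1 ≤ 1 := by
  refine (min_le_left _ _).trans ((min_le_left _ _).trans ?_)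
  exact Real.rpow_le_one_of_one_le_of_nonpos (by norm_num) (by norm_num)

lemma ΔP1_mul_CUp_sq : c.ΔP1 * c.CUp ^ 2 ≤ 1 / 2 := by
  have hC := c.CUp_pos
  have h : c.ΔP1 ≤ 1 / ((2 : ℝ) ^ (31 / 21 : ℝ) * c.CUp ^ 2) :=
    (min_le_left _ _).trans (min_le_right _ _)
  have h2 : (2 : ℝ) ≤ (2 : ℝ) ^ (31 / 21 : ℝ) := by
    conv_lhs => rw [← Real.rpow_one 2]
    exact Real.rpow_le_rpow_of_exponent_le (by norm_num) (by norm_num)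
  calc _ ≤ 1 / ((2 : ℝ) ^ (31 / 21 : ℝ) * c.CUp ^ 2) * c.CUp ^ 2 := by gcongr
    _ = 1 / (2 : ℝ) ^ (31 / 21 : ℝ) := by field_simp
    _ ≤ 1 / 2 := one_div_le_one_div_of_le (by norm_num) h2

lemma ΔP1_mul_cUp_pow : c.ΔP1 * c.cUp ^ 4 ≤ 1 / 4 := by
  have hC := c.cUp_pos
  have h : c.ΔP1 ≤ 1 / (4 * c.cUp ^ 4) := (min_le_right _ _).trans (min_le_right _ _)
  calc _ ≤ 1 / (4 * c.cUp ^ 4) * c.cUp ^ 4 := by gcongr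
    _ = 1 / 4 := by field_simp

/-- If the exponent `L = Δ x^{2/7}` is at least `7`, deviations of order `L` are negligible
against `x`. -/
lemma scale_bounds {x L : ℝ} (hx : 1 ≤ x) (hL : L = c.ΔP1 * x ^ (2 / 7 : ℝ)) (hL7 : 7 ≤ L) :
    c.CLow * (2 * L + 1) ≤ x ∧ c.cUp ^ 2 * (2 * L + 1) ≤ x ∧
      5 * (c.CUp ^ 2 * (1 + (2 * L + 1)) ^ 2) ≤ 3 * x := by
  have hx0 : 0 < x := by linarith
  set X : ℝ := x ^ (2 / 7 : ℝ) with hX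
  have hX0 : 0 < X := Real.rpow_pos_of_pos hx0 _
  -- The exponent `6/7` is at most `1`; a spare factor `X ≥ 7` will absorb the numerical constants.
  have hXx : X ^ 3 ≤ x := by
    rw [hX, ← Real.rpow_natCast, ← Real.rpow_mul hx0.le]
    conv_rhs => rw [← Real.rpow_one x]
    exact Real.rpow_le_rpow_of_exponent_le hx (by norm_num)
  have hΔ := c.ΔP1_pos
  have hLX : L ≤ X := by
    rw [hL]; exact mul_le_of_le_one_left hX0.le c.ΔP1_le_one
  have b1 : c.CUp ^ 2 * L ≤ X / 2 := by
    rw [hL]; nlinarith [c.ΔP1_mul_CUp_sq]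
  have b2 : c.cUp ^ 4 * L ≤ X / 4 := by
    rw [hL]; nlinarith [c.ΔP1_mul_cUp_pow]
  have hX7 : 7 ≤ X := hL7.trans hLX
  have hX3 : 49 * X ≤ X ^ 3 := by
    nlinarith [mul_nonneg (by linarith : 0 ≤ X - 7) hX0.le,
      mul_nonneg (mul_nonneg (by linarith : 0 ≤ X - 7) hX0.le) hX0.le]
  have hL2 : 2 * L + 1 ≤ 3 * L := by linarith
  have hCL := c.CLow_le_CUp
  have hCL0 := c.CLow_pos
  refine ⟨?_, ?_, ?_⟩
  · have h1 : c.CLow ≤ 1 + c.CUp ^ 2 := by nlinarith [sq_nonneg (c.CUp - 1)]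
    calc _ ≤ (1 + c.CUp ^ 2) * (3 * L) := by gcongr
      _ = 3 * L + 3 * (c.CUp ^ 2 * L) := by ring
      _ ≤ x := by linarith
  · have h1 : c.cUp ^ 2 ≤ 1 + c.cUp ^ 4 := by nlinarith [sq_nonneg (c.cUp ^ 2 - 1)]
    calc _ ≤ (1 + c.cUp ^ 4) * (3 * L) := by gcongr
      _ = 3 * L + 3 * (c.cUp ^ 4 * L) := by ring
      _ ≤ x := by linarith
  · have h2 : 1 + (2 * L + 1) ≤ 16 / 7 * L := by linarith
    calc _ ≤ 5 * (c.CUp ^ 2 * (16 / 7 * L) ^ 2) := by gcongr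
      _ = 1280 / 49 * (c.CUp ^ 2 * L * L) := by ring
      _ ≤ 1280 / 49 * (X / 2 * X) := by gcongr
      _ ≤ 3 * X ^ 3 := by
        nlinarith [mul_nonneg (by linarith : 0 ≤ X - 7) (mul_nonneg hX0.le hX0.le)]
      _ ≤ 3 * x := by linarith

lemma eP1_nonneg (M K : ℕ) {R : ℝ} (hR : 0 ≤ R) : 0 ≤ c.eP1 M K R := by
  have h : (1 : ℝ) ≤ 2 ^ (2 * R) := Real.one_le_rpow (by norm_num) (by linarith)
  unfold eP1
  have : 0 ≤ (2 : ℝ) ^ (2 * R) - 1 := by linarith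
  positivity

/-- The defining property of `x(R)`. -/
lemma xP1_spec {M K : ℕ} (hM : 0 < M) (hK : 0 < K) {R : ℝ} (hR : 0 ≤ R)
    (hx : 0 < c.xP1 M K R) :
    2 * √(K : ℝ) * c.xP1 M K R < Real.pi * c.CLow * K / (4 * M) ∧
    (2 ^ (2 * R) - 1) * (K * M * (c.CSN ^ 2 + 3 * c.xP1 M K R / √(M : ℝ)
        + c.σ ^ 2 * c.xP1 M K R / √(K : ℝ)))
      ≤ (Real.pi * c.CLow * K / (4 * M) - 2 * √(K : ℝ) * c.xP1 M K R) ^ 2 := by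
  have he := c.eP1_nonneg M K hR
  have hC := c.CLow_pos
  have hS := c.CSN_pos
  have hσ := c.σ_pos
  have hM' : (0 : ℝ) < M := by exact_mod_cast hM
  have hK' : (0 : ℝ) < K := by exact_mod_cast hK
  have hr : 0 < √(M : ℝ) := Real.sqrt_pos.2 hM'
  have ht : 0 < √(K : ℝ) := Real.sqrt_pos.2 hK'
  have htt : √(K : ℝ) ^ 2 = K := Real.sq_sqrt hK'.le
  have hpi := Real.pi_pos
  set x := c.xP1 M K R with hxd
  set e := c.eP1 M K R with hed
  set r := √(M : ℝ)
  set t := √(K : ℝ)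
  set s : ℝ := 2 ^ (2 * R) - 1 with hs
  have hden : 0 < 16 / (c.CLow * Real.pi) * (M / t) +
      e * (3 / c.CSN ^ 2 * (1 / r) + c.σ ^ 2 / c.CSN ^ 2 * (1 / t)) := by positivity
  -- Dropping the square `(2 t x)²` from `(A - 2 t x)²` leaves a sufficient condition linear in `x`;
  -- `x(R)` satisfies it with equality.
  have key : x * (16 / (c.CLow * Real.pi) * (M / t) +
      e * (3 / c.CSN ^ 2 * (1 / r) + c.σ ^ 2 / c.CSN ^ 2 * (1 / t))) = 1 - e := by
    rw [hxd, xP1]; exact div_mul_cancel₀ _ hden.ne'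
  set A := Real.pi * c.CLow * K / (4 * M) with hA
  have hA0 : 0 < A := by positivity
  have hAx : x * (16 / (c.CLow * Real.pi) * (M / t)) * A = 4 * t * x := by
    rw [hA, ← htt]; field_simp; ring
  have hse : s * (K * M * c.CSN ^ 2) = e * A ^ 2 := by
    rw [hed, eP1, ← hs, hA]; field_simp; ring
  have hle : x * (16 / (c.CLow * Real.pi) * (M / t)) ≤ 1 := by
    have : 0 ≤ x * (e * (3 / c.CSN ^ 2 * (1 / r) + c.σ ^ 2 / c.CSN ^ 2 * (1 / t))) := by
      positivity
    nlinarith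
  have h4 : 4 * t * x ≤ A := by
    rw [← hAx]; exact mul_le_of_le_one_left hA0.le hle
  refine ⟨by nlinarith [mul_pos ht hx], ?_⟩
  have e1 : s * (K * M * (c.CSN ^ 2 + 3 * x / r + c.σ ^ 2 * x / t))
      = s * (K * M * c.CSN ^ 2) *
        (1 + x * (3 / c.CSN ^ 2 * (1 / r) + c.σ ^ 2 / c.CSN ^ 2 * (1 / t))) := by
    field_simp; ring
  have e2 : e * (1 + x * (3 / c.CSN ^ 2 * (1 / r) + c.σ ^ 2 / c.CSN ^ 2 * (1 / t)))
      = 1 - x * (16 / (c.CLow * Real.pi) * (M / t)) := by linarith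
  calc _ = A ^ 2 * (e * (1 + x * (3 / c.CSN ^ 2 * (1 / r) + c.σ ^ 2 / c.CSN ^ 2 * (1 / t)))) := by
        rw [e1, hse]; ring
    _ = A ^ 2 - A * (x * (16 / (c.CLow * Real.pi) * (M / t)) * A) := by rw [e2]; ring
    _ = A ^ 2 - A * (4 * t * x) := by rw [hAx]
    _ ≤ _ := by nlinarith [sq_nonneg (t * x)]

end RelayConstants

/-! ### Outage bounds for finite networks. -/

/-- The outage probability bound without the factor `K²`. -/
lemma RelayNetwork.outageProb_le_exp {c : RelayConstants} {K M : ℕ} (N : RelayNetwork c K M)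
    (hK : 0 < K) (m : Fin M) {R : ℝ} (hR : 0 ≤ R) (hx : 1 ≤ c.xP1 M K R)
    (hL : 7 ≤ c.ΔP1 * c.xP1 M K R ^ (2 / 7 : ℝ))
    {Ω : Type*} [MeasurableSpace Ω] (μ : Measure Ω) [IsProbabilityMeasure μ]
    (h : Fin K → Fin M → Ω → ℂ) (f : Fin M → Fin K → Ω → ℂ) (hc : IsRayleighChannel μ h f) :
    N.outageProb μ h f m R
      ≤ (2 * M + 2) * Real.exp (-(c.ΔP1 * c.xP1 M K R ^ (2 / 7 : ℝ))) := by
  obtain ⟨b1, b2, b3⟩ := c.scale_bounds hx rfl hL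
  set L := c.ΔP1 * c.xP1 M K R ^ (2 / 7 : ℝ)
  obtain ⟨s1, s2⟩ := c.xP1_spec (N.numPairs_pos hK) hK hR (by linarith)
  -- The choice `y = 2L + 1` turns `exp(1/2 - y/2)` into `exp(-L)`.
  have hy : 0 ≤ 2 * L + 1 := by linarith
  have h1 : (1 : ℝ) ≤ 2 ^ (2 * R) := Real.one_le_rpow (by norm_num) (by linarith)
  have := N.outageProb_le hK m (R := R) hy (fun h f T => ?_) μ h f hc
  · refine this.trans (le_of_eq ?_)
    congr 2; ring
  · have hS := T.lt_SINR hK hy hx (by linarith) b1 b2 b3 s1 s2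
    have hlog : 2 * R < Real.logb 2 (1 + N.SINR h f m) := by
      rw [Real.lt_logb_iff_rpow_lt (by norm_num) (by linarith)]
      linarith
    linarith

lemma outageProb_le_outageBoundP1 {c : RelayConstants} {K M : ℕ} (N : RelayNetwork c K M)
    (hK : 2 ≤ K) (hM : 2 ≤ M) (m : Fin M) {R : ℝ} (hR : 0 ≤ R) (hx : 1 ≤ c.xP1 M K R)
    {Ω : Type*} [MeasurableSpace Ω] (μ : Measure Ω) [IsProbabilityMeasure μ]
    (h : Fin K → Fin M → Ω → ℂ) (f : Fin M → Fin K → Ω → ℂ) (hc : IsRayleighChannel μ h f) :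
    N.outageProb μ h f m R ≤ c.outageBoundP1 M K R := by
  have hK' : (2 : ℝ) ≤ K := by exact_mod_cast hK
  have hM' : (2 : ℝ) ≤ M := by exact_mod_cast hM
  have hK2 : (4 : ℝ) ≤ (K : ℝ) ^ 2 := by nlinarith
  unfold RelayConstants.outageBoundP1
  set L := c.ΔP1 * c.xP1 M K R ^ (2 / 7 : ℝ) with hLd
  rcases le_or_gt 7 L with hL | hL
  · refine (N.outageProb_le_exp (by omega) m hR hx hL μ h f hc).trans ?_
    gcongr
    nlinarith
  · have h1 : N.outageProb μ h f m R ≤ 1 := measureReal_le_one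
    -- For `L < 7` the bound is trivial: `151 K² M ≥ 151 · 4 · 2 = 1208 ≥ e⁷`.
    have h2 : Real.exp 7 ≤ 151 * (K : ℝ) ^ 2 * M := by
      have : Real.exp 7 ≤ 1208 := by
        have h3 : Real.exp 7 = Real.exp 1 ^ 7 := by rw [← Real.exp_nat_mul]; norm_num
        rw [h3]
        have := Real.exp_one_lt_d9
        calc Real.exp 1 ^ 7 ≤ 2.7182818286 ^ 7 := by gcongr
          _ ≤ 1208 := by norm_num
      nlinarith
    calc _ ≤ 1 := h1
      _ = Real.exp 7 * Real.exp (-7) := by rw [← Real.exp_add]; norm_num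
      _ ≤ _ := by gcongr

/-! ### Lower bounds on `x(R)` below the rate limit. -/

namespace RelayConstants
variable (c : RelayConstants)

lemma eP1_le_of_le_rateLimitP1 {ε : ℝ} (hε : ε < 1) {M K : ℕ} (hM : 0 < M) (hK : 0 < K) {R : ℝ}
    (hR : R ≤ c.rateLimitP1 ε M K) : c.eP1 M K R ≤ 1 - ε := by
  have hC := c.CLow_pos
  have hS := c.CSN_pos
  have hM' : (0 : ℝ) < M := by exact_mod_cast hM
  have hK' : (0 : ℝ) < K := by exact_mod_cast hK
  have hpi := Real.pi_pos
  have hε' : 0 < 1 - ε := by linarith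
  unfold rateLimitP1 at hR
  set Z := Real.pi ^ 2 / 16 * (c.CLow ^ 2 / c.CSN ^ 2) * ((K : ℝ) / (M : ℝ) ^ 3) * (1 - ε) with hZ
  have hZ0 : 0 < Z := by positivity
  have h : (2 : ℝ) ^ (2 * R) ≤ 1 + Z :=
    (Real.le_logb_iff_rpow_le (by norm_num) (by linarith)).1 (by linarith)
  unfold eP1
  calc _ ≤ 16 / Real.pi ^ 2 * (c.CSN ^ 2 / c.CLow ^ 2) * ((M : ℝ) ^ 3 / K) * Z := by
        gcongr; linarith
    _ = 1 - ε := by rw [hZ]; field_simp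

/-- The coefficient of `M / √K` in the denominator of `x(R)`. -/
noncomputable def xDenDirect : ℝ := 16 / (c.CLow * Real.pi)

/-- An upper bound on the coefficient of `e / √M` in the denominator of `x(R)`. -/
noncomputable def xDenNoise : ℝ := (3 + c.σ ^ 2) / c.CSN ^ 2

lemma xDenDirect_pos : 0 < c.xDenDirect := by
  have := c.CLow_pos
  unfold xDenDirect
  positivity

lemma xDenNoise_pos : 0 < c.xDenNoise := by
  have := c.CSN_pos
  unfold xDenNoise
  positivity

lemma le_xP1 {ε B : ℝ} (hε : 0 < ε) {M K : ℕ} (hM : 0 < M) (hMK : M ≤ K) {R : ℝ} (hR : 0 ≤ R)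
    (he : c.eP1 M K R ≤ 1 - ε)
    (hB : c.xDenDirect * (M / √(K : ℝ)) + c.eP1 M K R * (c.xDenNoise * (1 / √(M : ℝ))) ≤ B) :
    ε / B ≤ c.xP1 M K R := by
  have he0 := c.eP1_nonneg M K hR
  have hS := c.CSN_pos
  have hd := c.xDenDirect_pos
  have hM' : (0 : ℝ) < M := by exact_mod_cast hM
  have hMK' : (M : ℝ) ≤ K := by exact_mod_cast hMK
  have hK' : (0 : ℝ) < K := hM'.trans_le hMK'
  have hr : 0 < √(M : ℝ) := Real.sqrt_pos.2 hM'
  have ht : 0 < √(K : ℝ) := Real.sqrt_pos.2 hK'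
  have hrt : √(M : ℝ) ≤ √(K : ℝ) := Real.sqrt_le_sqrt hMK'
  unfold xP1
  have hd' : 0 < 16 / (c.CLow * Real.pi) := hd
  have hle : 16 / (c.CLow * Real.pi) * (M / √(K : ℝ)) + c.eP1 M K R *
      (3 / c.CSN ^ 2 * (1 / √(M : ℝ)) + c.σ ^ 2 / c.CSN ^ 2 * (1 / √(K : ℝ))) ≤ B := by
    refine le_trans ?_ hB
    have h1 : c.xDenNoise * (1 / √(M : ℝ))
        = 3 / c.CSN ^ 2 * (1 / √(M : ℝ)) + c.σ ^ 2 / c.CSN ^ 2 * (1 / √(M : ℝ)) := by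
      unfold xDenNoise; ring
    rw [h1]
    unfold xDenDirect
    gcongr
  apply div_le_div₀ (by linarith) (by linarith) (by positivity) hle

/-- From `M³ ≤ K` comes `M/√K ≤ 1/√M`, and `e ≤ 1`; so the whole denominator of `x(R)` is `O(1/√M)`.
-/
lemma mul_sqrt_le_xP1 {ε : ℝ} (hε : 0 < ε) {M K : ℕ} (hM : 0 < M) (hMK : (M : ℝ) ^ 3 ≤ K) {R : ℝ}
    (hR : 0 ≤ R) (he : c.eP1 M K R ≤ 1 - ε) :
    ε / (c.xDenDirect + c.xDenNoise) * √(M : ℝ) ≤ c.xP1 M K R := by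
  have hd := c.xDenDirect_pos
  have hd' := c.xDenNoise_pos
  have hM' : (1 : ℝ) ≤ M := by exact_mod_cast hM
  have hMK' : (M : ℝ) ≤ K := le_trans (le_self_pow₀ hM' (by norm_num)) hMK
  have hr : 0 < √(M : ℝ) := Real.sqrt_pos.2 (by linarith)
  have ht : 0 < √(K : ℝ) := Real.sqrt_pos.2 (by linarith)
  have h1 : (M : ℝ) / √(K : ℝ) ≤ 1 / √(M : ℝ) := by
    rw [div_le_div_iff₀ ht hr, one_mul]
    refine Real.le_sqrt_of_sq_le ?_
    rw [mul_pow, Real.sq_sqrt (by linarith)]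
    linarith [pow_succ (M : ℝ) 2]
  have h := c.le_xP1 hε hM (by exact_mod_cast hMK') hR he
    (B := (c.xDenDirect + c.xDenNoise) * (1 / √(M : ℝ))) (by
      rw [add_mul]
      refine add_le_add (by gcongr) (mul_le_of_le_one_left (by positivity) (by linarith)))
  refine le_trans (le_of_eq ?_) h
  field_simp

lemma eP1_mono (M K : ℕ) {R R' : ℝ} (h : R ≤ R') : c.eP1 M K R ≤ c.eP1 M K R' := by
  unfold eP1
  have : (2 : ℝ) ^ (2 * R) ≤ 2 ^ (2 * R') :=
    Real.rpow_le_rpow_of_exponent_le (by norm_num) (by linarith)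
  gcongr

/-- For bounded rates, `x(R)` is at least a multiple of a power of `K`. -/
lemma mul_rpow_le_xP1 {ε δ R₀ : ℝ} (hε : 0 < ε) (hδ : 0 < δ) (hR₀ : 0 ≤ R₀) :
    ∃ κ > (0 : ℝ), ∃ α > (0 : ℝ), ∀ (M K : ℕ) (R : ℝ), 0 < M → (M : ℝ) ^ (3 + δ) ≤ K →
      0 ≤ R → R ≤ R₀ → c.eP1 M K R ≤ 1 - ε → κ * (K : ℝ) ^ α ≤ c.xP1 M K R := by
  have hd := c.xDenDirect_pos
  have hd' := c.xDenNoise_pos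
  set D : ℝ := 16 / Real.pi ^ 2 * (c.CSN ^ 2 / c.CLow ^ 2) * ((2 : ℝ) ^ (2 * R₀) - 1) with hD
  have hD0 : 0 ≤ D := by
    have : (1 : ℝ) ≤ 2 ^ (2 * R₀) := Real.one_le_rpow (by norm_num) (by linarith)
    have : (0 : ℝ) ≤ 2 ^ (2 * R₀) - 1 := by linarith
    positivity
  -- The exponent `1/6` comes from `M/√K ≤ K^(1/(3+δ) - 1/2)`, and `δ/(3+δ)` from `e ≤ D M³/K` with
  -- `M ≤ K^(1/(3+δ))`.
  refine ⟨ε / (c.xDenDirect + D * c.xDenNoise), by positivity, min (1 / 6) (δ / (3 + δ)),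
    lt_min (by norm_num) (by positivity), fun M K R hM hMK hR hR0 he => ?_⟩
  set α := min (1 / 6) (δ / (3 + δ)) with hα
  have hM' : (1 : ℝ) ≤ M := by exact_mod_cast hM
  have hMM : (M : ℝ) ≤ (M : ℝ) ^ (3 + δ) := by
    conv_lhs => rw [← Real.rpow_one (M : ℝ)]
    exact Real.rpow_le_rpow_of_exponent_le hM' (by linarith)
  have hMK' : (M : ℝ) ≤ K := hMM.trans hMK
  have hK' : (1 : ℝ) ≤ K := hM'.trans hMK'
  have hK0 : (0 : ℝ) < K := by linarith
  have hr1 : 1 ≤ √(M : ℝ) := Real.one_le_sqrt.2 hM'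
  have hMle : (M : ℝ) ≤ (K : ℝ) ^ (1 / (3 + δ)) := by
    have h := Real.rpow_le_rpow (by positivity) hMK (z := 1 / (3 + δ)) (by positivity)
    rwa [← Real.rpow_mul (by positivity), mul_one_div_cancel (by positivity), Real.rpow_one] at h
  have h1 : (M : ℝ) / √(K : ℝ) ≤ (K : ℝ) ^ (-α) := by
    calc (M : ℝ) / √(K : ℝ) ≤ (K : ℝ) ^ (1 / (3 + δ)) / √(K : ℝ) := by gcongr
      _ = (K : ℝ) ^ (1 / (3 + δ) - 1 / 2) := by rw [Real.rpow_sub hK0, Real.sqrt_eq_rpow]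
      _ ≤ _ := by
        refine Real.rpow_le_rpow_of_exponent_le hK' ?_
        have : 1 / (3 + δ) ≤ 1 / 3 := one_div_le_one_div_of_le (by norm_num) (by linarith)
        have : α ≤ 1 / 6 := min_le_left _ _
        linarith
  have h2 : (M : ℝ) ^ 3 / K ≤ (K : ℝ) ^ (-α) := by
    calc (M : ℝ) ^ 3 / K ≤ ((K : ℝ) ^ (1 / (3 + δ))) ^ 3 / K := by gcongr
      _ = (K : ℝ) ^ (1 / (3 + δ) * 3 - 1) := by
        rw [Real.rpow_sub hK0, Real.rpow_one, ← Real.rpow_natCast, ← Real.rpow_mul hK0.le]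
        norm_num
      _ ≤ _ := by
        refine Real.rpow_le_rpow_of_exponent_le hK' ?_
        have : α ≤ δ / (3 + δ) := min_le_right _ _
        have e : 1 / (3 + δ) * 3 - 1 = -(δ / (3 + δ)) := by field_simp; ring
        linarith
  have h3 : c.eP1 M K R ≤ D * (K : ℝ) ^ (-α) := by
    refine (c.eP1_mono M K hR0).trans ?_
    calc c.eP1 M K R₀ = D * ((M : ℝ) ^ 3 / K) := by rw [hD, eP1]; ring
      _ ≤ _ := by gcongr
  have h := c.le_xP1 hε hM (by exact_mod_cast hMK') hR he
    (B := (c.xDenDirect + D * c.xDenNoise) * (K : ℝ) ^ (-α)) (by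
      have h4 : c.xDenNoise * (1 / √(M : ℝ)) ≤ c.xDenNoise :=
        mul_le_of_le_one_right hd'.le (by rw [div_le_one (by linarith)]; exact hr1)
      calc _ ≤ c.xDenDirect * (K : ℝ) ^ (-α) + D * (K : ℝ) ^ (-α) * c.xDenNoise := by gcongr
        _ = _ := by ring)
  refine le_trans (le_of_eq ?_) h
  rw [Real.rpow_neg hK0.le]
  have := Real.rpow_pos_of_pos hK0 α
  field_simp

end RelayConstants

/-! ### Passage to the limit. -/

lemma tendsto_exp_mul_sub_mul {u w : ℕ → ℝ} {η C : ℝ} (hη : 0 < η) (hC : 0 < C)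
    (hw : Tendsto w atTop atTop) (hu : Tendsto (fun n => u n / w n) atTop (𝓝 0)) :
    Tendsto (fun n => Real.exp (C * u n - η * w n)) atTop (𝓝 0) := by
  refine Real.tendsto_exp_atBot.comp ?_
  refine tendsto_atBot_mono' atTop ?_
    ((tendsto_const_mul_atBot_of_neg (show -(η / 2) < 0 by linarith)).2 hw)
  filter_upwards [hw.eventually_gt_atTop 0, hu.eventually_lt_const (show 0 < η / (2 * C) by
    positivity)] with n h1 h2
  rw [div_lt_div_iff₀ h1 (by positivity)] at h2
  linarith

lemma tendsto_log_div_rpow {u : ℕ → ℝ} (hu : Tendsto u atTop atTop) {α : ℝ} (hα : 0 < α) :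
    Tendsto (fun n => Real.log (u n) / u n ^ α) atTop (𝓝 0) :=
  (isLittleO_log_rpow_atTop hα).tendsto_div_nhds_zero.comp hu

/-- Since `M ≤ K`, the prefactor `K² M` is at most `exp(3 log K)`, which loses against `exp(-η w)`.
-/
lemma RelayConstants.tendsto_outageBoundP1 (c : RelayConstants) {M K : ℕ → ℕ} {R w : ℕ → ℝ}
    {η : ℝ} (hη : 0 < η) (hM : ∀ᶠ n in atTop, 0 < M n) (hMK : ∀ᶠ n in atTop, M n ≤ K n)
    (hw : Tendsto w atTop atTop) (hu : Tendsto (fun n => Real.log (K n) / w n) atTop (𝓝 0))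
    (hx : ∀ᶠ n in atTop, η * w n ≤ c.ΔP1 * c.xP1 (M n) (K n) (R n) ^ (2 / 7 : ℝ)) :
    Tendsto (fun n => c.outageBoundP1 (M n) (K n) (R n)) atTop (𝓝 0) := by
  have h := (tendsto_exp_mul_sub_mul hη (show (0 : ℝ) < 3 by norm_num) hw hu).const_mul 151
  rw [mul_zero] at h
  refine squeeze_zero' (Eventually.of_forall fun n => ?_) ?_ h
  · unfold outageBoundP1; positivity
  · filter_upwards [hM, hMK, hx] with n h1 h2 h3
    have hK : (0 : ℝ) < K n := by exact_mod_cast h1.trans_le h2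
    have h2' : (M n : ℝ) ≤ K n := by exact_mod_cast h2
    have e : Real.exp (3 * Real.log (K n)) = (K n : ℝ) ^ 3 := by
      rw [show (3 : ℝ) = ((3 : ℕ) : ℝ) by norm_num, Real.exp_nat_mul, Real.exp_log hK]
    unfold outageBoundP1
    calc _ ≤ 151 * (K n : ℝ) ^ 2 * K n * Real.exp (-(η * w n)) := by gcongr
      _ = _ := by rw [sub_eq_add_neg, Real.exp_add, e]; ring

lemma RelayConstants.mul_le_ΔP1_mul_rpow (c : RelayConstants) {κ v x : ℝ} (hκ : 0 < κ) (hv : 0 ≤ v)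
    (h : κ * v ≤ x) :
    c.ΔP1 * κ ^ (2 / 7 : ℝ) * v ^ (2 / 7 : ℝ) ≤ c.ΔP1 * x ^ (2 / 7 : ℝ) := by
  have := c.ΔP1_pos
  rw [mul_assoc, ← Real.mul_rpow hκ.le hv]
  gcongr

lemma pow_three_le_of_rpow_le {δ : ℝ} (hδ : 0 < δ) {M K : ℕ} (hM : 0 < M)
    (h : (M : ℝ) ^ (3 + δ) ≤ K) : (M : ℝ) ^ 3 ≤ K := by
  refine le_trans ?_ h
  rw [← Real.rpow_natCast]
  exact Real.rpow_le_rpow_of_exponent_le (by exact_mod_cast hM) (by push_cast; linarith)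

theorem theorem5 (c : RelayConstants) :
    -- Part 1: the bound for finite `K`, `M`
    (∀ (K M : ℕ) (R : ℝ), 2 ≤ K → 2 ≤ M → 0 ≤ R → 1 ≤ c.xP1 M K R →
      ∀ (N : RelayNetwork c K M) (Ω : Type*) [MeasurableSpace Ω] (μ : Measure Ω)
        [IsProbabilityMeasure μ] (h : Fin K → Fin M → Ω → ℂ) (f : Fin M → Fin K → Ω → ℂ),
        IsRayleighChannel μ h f → ∀ m : Fin M,
          N.outageProb μ h f m R ≤ c.outageBoundP1 M K R) ∧
    -- Part 2: the limit
    (∀ (ε δ : ℝ), 0 < ε → ε < 1 → 0 < δ →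
      ∀ (M K : ℕ → ℕ) (R : ℕ → ℝ), Tendsto M atTop atTop →
        (∀ n, (M n : ℝ) ^ (3 + δ) ≤ (K n : ℝ)) →
        (∀ n, 0 ≤ R n) → (∀ n, R n ≤ c.rateLimitP1 ε (M n) (K n)) →
        -- the bound tends to 0, for bounded rates or for subexponentially many relays
        ((BddAbove (Set.range R) ∨
            Tendsto (fun n => Real.log (K n) / (M n : ℝ) ^ (1 / 7 : ℝ)) atTop (𝓝 0)) →
          Tendsto (fun n => c.outageBoundP1 (M n) (K n) (R n)) atTop (𝓝 0)) ∧
        -- the outage probability tends to 0 in all cases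
        (∀ (N : ∀ n, RelayNetwork c (K n) (M n)) (Ω : ℕ → Type*) [∀ n, MeasurableSpace (Ω n)]
          (μ : ∀ n, Measure (Ω n)) [∀ n, IsProbabilityMeasure (μ n)]
          (h : ∀ n, Fin (K n) → Fin (M n) → Ω n → ℂ) (f : ∀ n, Fin (M n) → Fin (K n) → Ω n → ℂ),
          (∀ n, IsRayleighChannel (μ n) (h n) (f n)) → ∀ m : ∀ n, Fin (M n),
            Tendsto (fun n => (N n).outageProb (μ n) (h n) (f n) (m n) (R n)) atTop (𝓝 0))) := by
  refine ⟨fun K M R hK hM hR hx N Ω _ μ _ h f hc m =>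
    outageProb_le_outageBoundP1 N hK hM m hR hx μ h f hc, ?_⟩
  intro ε δ hε hε1 hδ M K R hM hMK hR hRl
  have hΔ := c.ΔP1_pos
  have hMpos : ∀ᶠ n in atTop, 0 < M n := hM.eventually_gt_atTop 0
  have hM' : Tendsto (fun n => (M n : ℝ)) atTop atTop := tendsto_natCast_atTop_atTop.comp hM
  have hK3 : ∀ n, 0 < M n → (M n : ℝ) ^ 3 ≤ K n := fun n hn => pow_three_le_of_rpow_le hδ hn (hMK n)
  have hMleK : ∀ n, 0 < M n → M n ≤ K n := fun n hn => by
    have h1 : (1 : ℝ) ≤ M n := by exact_mod_cast hn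
    exact_mod_cast (le_self_pow₀ h1 (by norm_num)).trans (hK3 n hn)
  have he : ∀ n, 0 < M n → c.eP1 (M n) (K n) (R n) ≤ 1 - ε := fun n hn =>
    c.eP1_le_of_le_rateLimitP1 hε1 hn (hn.trans_le (hMleK n hn)) (hRl n)
  have hK' : Tendsto (fun n => (K n : ℝ)) atTop atTop :=
    tendsto_atTop_mono' _ (hMpos.mono fun n hn => Nat.cast_le.2 (hMleK n hn)) hM'
  have hw : Tendsto (fun n => (M n : ℝ) ^ (1 / 7 : ℝ)) atTop atTop :=
    (tendsto_rpow_atTop (by norm_num)).comp hM'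
  set κ := ε / (c.xDenDirect + c.xDenNoise) with hκ
  have hκ0 : 0 < κ := div_pos hε (add_pos c.xDenDirect_pos c.xDenNoise_pos)
  have hxM : ∀ n, 0 < M n → κ * √(M n : ℝ) ≤ c.xP1 (M n) (K n) (R n) := fun n hn =>
    c.mul_sqrt_le_xP1 hε hn (hK3 n hn) (hR n) (he n hn)
  set η := c.ΔP1 * κ ^ (2 / 7 : ℝ) with hη
  have hη0 : 0 < η := mul_pos hΔ (Real.rpow_pos_of_pos hκ0 _)
  have hLM : ∀ n, 0 < M n →
      η * (M n : ℝ) ^ (1 / 7 : ℝ) ≤ c.ΔP1 * c.xP1 (M n) (K n) (R n) ^ (2 / 7 : ℝ) := fun n hn => by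
    have h := c.mul_le_ΔP1_mul_rpow hκ0 (Real.sqrt_nonneg _) (hxM n hn)
    rwa [Real.sqrt_eq_rpow, ← Real.rpow_mul (Nat.cast_nonneg _),
      show (1 / 2 : ℝ) * (2 / 7) = 1 / 7 by norm_num] at h
  refine ⟨?_, ?_⟩
  · rintro (hb | hlog)
    · obtain ⟨R₀, hR₀⟩ := hb
      have hR₀' : ∀ n, R n ≤ R₀ := fun n => hR₀ ⟨n, rfl⟩
      obtain ⟨κ', hκ', α, hα, hx⟩ :=
        c.mul_rpow_le_xP1 hε hδ ((hR 0).trans (hR₀' 0))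
      have hβ : 0 < α * (2 / 7) := by positivity
      refine c.tendsto_outageBoundP1 (w := fun n => (K n : ℝ) ^ (α * (2 / 7)))
        (mul_pos hΔ (Real.rpow_pos_of_pos hκ' (2 / 7))) hMpos (hMpos.mono hMleK)
        ((tendsto_rpow_atTop hβ).comp hK') (tendsto_log_div_rpow hK' hβ)
        (hMpos.mono fun n hn => ?_)
      have h := c.mul_le_ΔP1_mul_rpow hκ' (by positivity)
        (hx (M n) (K n) (R n) hn (hMK n) (hR n) (hR₀' n) (he n hn))
      rwa [← Real.rpow_mul (Nat.cast_nonneg _)] at h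
    · exact c.tendsto_outageBoundP1 hη0 hMpos (hMpos.mono hMleK) hw hlog (hMpos.mono hLM)
  · intro N Ω _ μ _ h f hc m
    -- Without the factor `K²` the prefactor is at most `4M`, so only `log M` must be negligible
    -- against `M^(1/7)`.
    have hlim := (tendsto_exp_mul_sub_mul hη0 one_pos hw
      (tendsto_log_div_rpow hM' (show (0 : ℝ) < 1 / 7 by norm_num))).const_mul 4
    rw [mul_zero] at hlim
    refine squeeze_zero' (Eventually.of_forall fun n => measureReal_nonneg) ?_ hlim
    have hx1 : ∀ᶠ n in atTop, 1 ≤ κ * √(M n : ℝ) :=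
      ((Real.tendsto_sqrt_atTop.comp hM').const_mul_atTop hκ0).eventually_ge_atTop 1
    have hL7 : ∀ᶠ n in atTop, 7 ≤ η * (M n : ℝ) ^ (1 / 7 : ℝ) :=
      (hw.const_mul_atTop hη0).eventually_ge_atTop 7
    filter_upwards [hMpos, hx1, hL7] with n hn h1 h7
    have hM1 : (1 : ℝ) ≤ M n := by exact_mod_cast hn
    refine ((N n).outageProb_le_exp (hn.trans_le (hMleK n hn)) (m n) (hR n)
      (h1.trans (hxM n hn)) (h7.trans (hLM n hn)) (μ n) (h n) (f n) (hc n)).trans ?_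
    calc _ ≤ (4 * M n : ℝ) * Real.exp (-(η * (M n : ℝ) ^ (1 / 7 : ℝ))) := by
          have := hLM n hn
          gcongr
          linarith
      _ = _ := by
          rw [one_mul, sub_eq_add_neg, Real.exp_add, Real.exp_log (by linarith)]; ring
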